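/- Let $M$ be a connected Hausdorff $C^\infty$ manifold of dimension $n\ge 2$, and let $F:TM\to[0,\infty)$ be a Finsler structure: $F$ is $C^\infty$ on the set $TM_0$ of nonzero tangent vectors, $F(x,\lambda y)=\lambda F(x,y)$ for all $\lambda>0$, and the matrix $g_{ij}=\left[\tfrac12F^2\right]_{y^iy^j}$ is positive definite on $TM_0$ ($F$ need not be reversible). In local coordinates $(x,y)$ on $TM$ (repeated indices are summed) let $$G^i=\tfrac12 g^{il}\left([F^2]_{x^ky^l}y^k-[F^2]_{x^l}\right),\qquad F^2\,Ric=\tfrac12\left(2(G^i)_{x^i}-\tfrac12(G^i)_{y^j}(G^j)_{y^i}-y^j(G^i)_{y^ix^j}+G^j(G^i)_{y^iy^j}\right),$$ and let $Ric_{ij}=\tfrac12\left[F^2\,Ric\right]_{y^iy^j}$ be the Ricci tensor. A geodesic parametrized by arc length $s$ is a smooth curve $x(s)$ with $F(x,x')=1$ and $x''^{\,i}+G^i(x,x')=0$. A smooth parameter $p=p(s)$ with $p'\ne0$ along such a geodesic is called projective if $$\frac{p'''}{p'}-\frac32\left(\frac{p''}{p'}\right)^2=\frac{2}{n-1}\,Ric_{jk}(x,x')\,x'^{\,j}x'^{\,k}.$$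 A map $f:I=(-1,1)\to M$ is called projective if $f(p(s))=x(s)$ for some arc length parametrized geodesic $x$ defined on an open interval $J$ and some projective parameter $p$ of it that maps $J$ bijectively onto $I$. Let $\rho(a,b)=\left|\ln\frac{(1-a)(1+b)}{(1-b)(1+a)}\right|$ be the Poincaré distance on $I$, and for $x,y\in M$ let $$d_M(x,y)=\inf\sum_{i=1}^k\rho(a_i,b_i),$$ where the infimum is over all $k\ge1$, points $x=x_0,x_1,\dots,x_k=y$ of $M$, pairs $a_i,b_i\in I$ and projective maps $f_i:I\to M$ with $f_i(a_i)=x_{i-1}$ and $f_i(b_i)=x_i$ for $i=1,\dots,k$. Suppose that for some constant $c>0$ we have $Ric_{ij}\le -c^2g_{ij}$ as matrices, at every point of $TM_0$. Then $d_M$ is a distance on $M$: for all $x,y,z\in M$, $d_M(x,y)$ is finite, $d_M(x,y)=0$ if and only if $x=y$, $d_M(x,y)=d_M(y,x)$, and $d_M(x,z)\le d_M(x,y)+d_M(y,z)$. -/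

import Mathlib

open scoped Manifold ContDiff Topology ENNReal

noncomputable section

namespace Finsler

/-! ### Coordinate expressions on a domain of `ℝⁿ × ℝⁿ`, with coordinates `(x, y)` -/

section Coordinates

variable {n : ℕ}

/-- The partial derivative `∂Φ/∂xⁱ` of a function `Φ(x, y)`. -/
def pderivX (i : Fin n) (Φ : EuclideanSpace ℝ (Fin n) × EuclideanSpace ℝ (Fin n) → ℝ)
    (z : EuclideanSpace ℝ (Fin n) × EuclideanSpace ℝ (Fin n)) : ℝ :=
  fderiv ℝ Φ z (EuclideanSpace.single i 1, 0)

/-- The partial derivative `∂Φ/∂yⁱ` of a function `Φ(x, y)`. -/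
def pderivY (i : Fin n) (Φ : EuclideanSpace ℝ (Fin n) × EuclideanSpace ℝ (Fin n) → ℝ)
    (z : EuclideanSpace ℝ (Fin n) × EuclideanSpace ℝ (Fin n)) : ℝ :=
  fderiv ℝ Φ z (0, EuclideanSpace.single i 1)

/-- The fundamental tensor `g_{ij} = [F²/2]_{yⁱyʲ}` of a function `F(x, y)`. -/
def fundamentalTensor (F : EuclideanSpace ℝ (Fin n) × EuclideanSpace ℝ (Fin n) → ℝ)
    (z : EuclideanSpace ℝ (Fin n) × EuclideanSpace ℝ (Fin n)) : Matrix (Fin n) (Fin n) ℝ :=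
  Matrix.of fun i j => pderivY j (pderivY i fun w => 1 / 2 * F w ^ 2) z

/-- The spray coefficients `Gⁱ = ½ g^{il} ([F²]_{xᵏyˡ} yᵏ - [F²]_{xˡ})`, normalized so that
the geodesic equation is `x'' + G(x, x') = 0`. -/
def spray (F : EuclideanSpace ℝ (Fin n) × EuclideanSpace ℝ (Fin n) → ℝ) (i : Fin n)
    (z : EuclideanSpace ℝ (Fin n) × EuclideanSpace ℝ (Fin n)) : ℝ :=
  1 / 2 * ∑ l, (fundamentalTensor F z)⁻¹ i l *
    ((∑ k, pderivY l (pderivX k fun w => F w ^ 2) z * z.2 k) - pderivX l (fun w => F w ^ 2) z)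

/-- The Riemann curvature `F² Rⁱₖ`, homogeneous of degree two in `y`:
`2 F² Rⁱₖ = 2 (Gⁱ)_{xᵏ} - ½ (Gⁱ)_{yʲ} (Gʲ)_{yᵏ} - yʲ (Gⁱ)_{yᵏxʲ} + Gʲ (Gⁱ)_{yᵏyʲ}`. -/
def riemannCurvature (F : EuclideanSpace ℝ (Fin n) × EuclideanSpace ℝ (Fin n) → ℝ)
    (i k : Fin n) (z : EuclideanSpace ℝ (Fin n) × EuclideanSpace ℝ (Fin n)) : ℝ :=
  1 / 2 * (2 * pderivX k (spray F i) z
    - 1 / 2 * (∑ j, pderivY j (spray F i) z * pderivY k (spray F j) z)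
    - (∑ j, z.2 j * pderivX j (pderivY k (spray F i)) z)
    + ∑ j, spray F j z * pderivY j (pderivY k (spray F i)) z)

/-- Akbar-Zadeh's Ricci tensor `Ric_{ik} = ½ (F² Ric)_{yⁱyᵏ}`, where `F² Ric = F² Rʲⱼ`. -/
def ricciTensor (F : EuclideanSpace ℝ (Fin n) × EuclideanSpace ℝ (Fin n) → ℝ)
    (z : EuclideanSpace ℝ (Fin n) × EuclideanSpace ℝ (Fin n)) : Matrix (Fin n) (Fin n) ℝ :=
  Matrix.of fun i k => 1 / 2 * pderivY k (pderivY i fun w => ∑ j, riemannCurvature F j j w) z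

end Coordinates

/-! ### Finsler structures on manifolds -/

section Manifold

variable {n : ℕ} {M : Type*} [TopologicalSpace M] [ChartedSpace (EuclideanSpace ℝ (Fin n)) M]
  [IsManifold (𝓡 n) ∞ M]

/-- The expression `F(x, y) = F(yⁱ ∂/∂xⁱ)` of a function on the tangent bundle in the
local coordinates given by a chart `e` (meaningful for `x ∈ e.target`). -/
def inChart (F : TangentBundle (𝓡 n) M → ℝ)
    (e : OpenPartialHomeomorph M (EuclideanSpace ℝ (Fin n)))
    (z : EuclideanSpace ℝ (Fin n) × EuclideanSpace ℝ (Fin n)) : ℝ :=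
  F ⟨e.symm z.1, mfderiv (𝓡 n) (𝓡 n) e.symm z.1 z.2⟩

variable (n M) in
/-- A (globally defined) Finsler structure on the manifold `M`. -/
structure FinslerStructure where
  /-- The Finsler function on the tangent bundle. -/
  toFun : TangentBundle (𝓡 n) M → ℝ
  nonneg : ∀ v, 0 ≤ toFun v
  /-- `F` is smooth on the slit tangent bundle. -/
  smooth : ContMDiffOn (𝓡 n).tangent 𝓘(ℝ, ℝ) ∞ toFun {v | v.2 ≠ 0}
  homogeneous : ∀ (x : M) (y : TangentSpace (𝓡 n) x) (t : ℝ), 0 < t →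
    toFun ⟨x, t • y⟩ = t * toFun ⟨x, y⟩
  /-- In local coordinates, `(g_{ij}(x, y))` is positive definite whenever `y ≠ 0`. -/
  strongly_convex : ∀ e ∈ IsManifold.maximalAtlas (𝓡 n) ∞ M, ∀ x ∈ e.target,
    ∀ y : EuclideanSpace ℝ (Fin n), y ≠ 0 →
      (fundamentalTensor (inChart toFun e) (x, y)).PosDef

/-- `Ric_{ij} ≤ κ g_{ij}` as matrices, at every nonzero tangent vector, in all local
coordinates. -/
def RicciLE (F : FinslerStructure n M) (κ : ℝ) : Prop :=
  ∀ e ∈ IsManifold.maximalAtlas (𝓡 n) ∞ M, ∀ x ∈ e.target,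
    ∀ y : EuclideanSpace ℝ (Fin n), y ≠ 0 →
      (κ • fundamentalTensor (inChart F.toFun e) (x, y)
        - ricciTensor (inChart F.toFun e) (x, y)).PosSemidef

/-- The curve `γ`, restricted to the open interval `J`, is a geodesic parametrized by arc
length. The equation `x'' + G(x, x') = 0` is invariant under changes of coordinates, so that
it is enough to have it, at each parameter value, in some chart around the point. -/
structure IsArcLengthGeodesicOn (F : FinslerStructure n M) (γ : ℝ → M) (J : Set ℝ) : Prop where
  smooth : ContMDiffOn 𝓘(ℝ, ℝ) (𝓡 n) ∞ γ J
  unit_speed : ∀ s ∈ J, F.toFun ⟨γ s, mfderiv 𝓘(ℝ, ℝ) (𝓡 n) γ s (1 : ℝ)⟩ = 1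
  geodesic : ∀ s ∈ J, ∃ e ∈ IsManifold.maximalAtlas (𝓡 n) ∞ M, γ s ∈ e.source ∧
    ∀ i, deriv (deriv (e ∘ γ)) s i
      + spray (inChart F.toFun e) i (e (γ s), deriv (e ∘ γ) s) = 0

/-- The Schwarzian derivative `{p, s} = p'''/p' - (3/2) (p''/p')²`. -/
def schwarzian (p : ℝ → ℝ) (s : ℝ) : ℝ :=
  deriv (deriv (deriv p)) s / deriv p s - 3 / 2 * (deriv (deriv p) s / deriv p s) ^ 2

/-- `p` is a projective parameter of the geodesic `γ`, whose arc length parameter `s` runs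
over the open interval `J`: it is a regular change of parameter and
`{p, s} = 2/(n-1) Ric_{jk}(x, x') x'ʲ x'ᵏ`. The right hand side does not depend on the
coordinates, so that it may be computed in any chart around the point. -/
structure IsProjectiveParameterOn (F : FinslerStructure n M) (γ : ℝ → M) (J : Set ℝ)
    (p : ℝ → ℝ) : Prop where
  smooth : ContDiffOn ℝ ∞ p J
  deriv_ne_zero : ∀ s ∈ J, deriv p s ≠ 0
  schwarzian_eq : ∀ s ∈ J, ∃ e ∈ IsManifold.maximalAtlas (𝓡 n) ∞ M, γ s ∈ e.source ∧
    schwarzian p s = 2 / ((n : ℝ) - 1) *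
      ∑ j, ∑ k, ricciTensor (inChart F.toFun e) (e (γ s), deriv (e ∘ γ) s) j k
        * deriv (e ∘ γ) s j * deriv (e ∘ γ) s k

/-- `f : I → M`, with `I = (-1, 1)`, is a projective map: a geodesic for which the natural
parameter `u = p(s)` of `I` is a projective parameter. Only the values of `f` on `I` matter. -/
def IsProjectiveMap (F : FinslerStructure n M) (f : ℝ → M) : Prop :=
  ∃ (J : Set ℝ) (γ : ℝ → M) (p : ℝ → ℝ), IsOpen J ∧ J.OrdConnected ∧
    IsArcLengthGeodesicOn F γ J ∧ IsProjectiveParameterOn F γ J p ∧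
    Set.BijOn p J (Set.Ioo (-1) 1) ∧ ∀ s ∈ J, f (p s) = γ s

/-- The Poincaré distance on `I = (-1, 1)`. -/
def poincareDist (a b : ℝ) : ℝ :=
  |Real.log (((1 - a) * (1 + b)) / ((1 - b) * (1 + a)))|

/-- A chain of `k ≥ 1` geodesic segments from `x` to `y`: points `x = x₀, …, x_k = y`, pairs
`aᵢ, bᵢ` in `I = (-1, 1)` and projective maps `fᵢ` with `fᵢ(aᵢ) = xᵢ`, `fᵢ(bᵢ) = xᵢ₊₁`
(`0 ≤ i < k`). -/
structure GeodesicChain (F : FinslerStructure n M) (x y : M) where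
  k : ℕ
  one_le : 1 ≤ k
  point : ℕ → M
  a : ℕ → ℝ
  b : ℕ → ℝ
  f : ℕ → ℝ → M
  point_zero : point 0 = x
  point_last : point k = y
  a_mem : ∀ i < k, a i ∈ Set.Ioo (-1 : ℝ) 1
  b_mem : ∀ i < k, b i ∈ Set.Ioo (-1 : ℝ) 1
  projective : ∀ i < k, IsProjectiveMap F (f i)
  map_a : ∀ i < k, f i (a i) = point i
  map_b : ∀ i < k, f i (b i) = point (i + 1)

/-- The length `∑ ρ(aᵢ, bᵢ)` of a chain. -/
def GeodesicChain.length {F : FinslerStructure n M} {x y : M} (α : GeodesicChain F x y) : ℝ :=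
  ∑ i ∈ Finset.range α.k, poincareDist (α.a i) (α.b i)

/-- The pseudo-distance `d_M(x, y)`: the infimum of the lengths of all chains of geodesic
segments from `x` to `y` (`∞` if there were no chain). -/
def pseudoDist (F : FinslerStructure n M) (x y : M) : ℝ≥0∞ :=
  ⨅ α : GeodesicChain F x y, ENNReal.ofReal α.length

end Manifold

end Finsler

end

/-!
Along a unit speed geodesic, `a = p''/p'` turns the equation of a projective parameter `p` into the
Riccati equation `a' = {p, s} + a²/2`. The geodesic system extended by `p` and `p'` can therefore
be solved from arbitrary initial velocities, and shooting from a suitable point joins it by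
projective maps to every point of a neighbourhood of a given point; connectedness then gives the
finiteness of `d_M`.

The separation of points is an Ahlfors–Schwarz argument. Let `p` be a projective parameter with
values in `(-1, 1)` and `r < 1`. Then `ψ = (r² - p²) / p'` vanishes at the ends of `{|p| < r}`, and
`-{p, s} ψ² ≤ 2 r²` holds at an interior maximum of `ψ`. As `{p, s} ≤ -2 c² / (n - 1)`, letting
`r → 1` bounds the Poincaré distance from below by `2 c / √(n - 1)` times the arc length. Bump
functions on `M` are Lipschitz in the arc length of geodesics, because the indicatrix is compact,
so a chain that joins two different points cannot be arbitrarily short.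
-/

noncomputable section

namespace Finsler

section Smoothness

variable {ι E : Type*} [Fintype ι] [DecidableEq ι] [NormedAddCommGroup E] [NormedSpace ℝ E]
  {m : WithTop ℕ∞} {A : E → Matrix ι ι ℝ} {S : Set E}

theorem contDiffOn_det (hA : ∀ i j, ContDiffOn ℝ m (fun z => A z i j) S) :
    ContDiffOn ℝ m (fun z => (A z).det) S := by
  simp only [Matrix.det_apply]
  exact ContDiffOn.sum fun σ _ => (contDiffOn_prod fun i _ => hA _ _).const_smul _

theorem contDiffOn_inv_apply (hA : ∀ i j, ContDiffOn ℝ m (fun z => A z i j) S)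
    (h0 : ∀ z ∈ S, (A z).det ≠ 0) (i j : ι) : ContDiffOn ℝ m (fun z => (A z)⁻¹ i j) S := by
  simp only [Matrix.inv_def, Matrix.smul_apply, Ring.inverse_eq_inv', smul_eq_mul,
    Matrix.adjugate_apply]
  refine ((contDiffOn_det hA).inv h0).mul (contDiffOn_det fun k l => ?_)
  simp only [Matrix.updateRow_apply]
  split_ifs
  · exact contDiffOn_const
  · exact hA k l

end Smoothness

section Slit

variable {E V : Type*} [Zero V]

/-- The trivial bundle `U × V` over `U` with its zero section removed; in a chart, this is the
slit tangent bundle on which a Finsler function is smooth. -/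
def slit (U : Set E) : Set (E × V) := U ×ˢ {0}ᶜ

theorem isOpen_slit [TopologicalSpace E] [TopologicalSpace V] [T1Space V] {U : Set E}
    (hU : IsOpen U) : IsOpen (slit U : Set (E × V)) :=
  hU.prod isOpen_compl_singleton

end Slit

section Homogeneity

variable {E V W : Type*} [NormedAddCommGroup E] [NormedSpace ℝ E] [NormedAddCommGroup V]
  [NormedSpace ℝ V] [NormedAddCommGroup W] [NormedSpace ℝ W]

/-- `Φ(x, y)` is positively homogeneous of degree `k` in `y ≠ 0`, for `x ∈ U`. -/
def IsPosHomogeneous (U : Set E) (k : ℕ) (Φ : E × V → W) : Prop :=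
  ∀ z ∈ slit U, ∀ t : ℝ, 0 < t → Φ (z.1, t • z.2) = t ^ k • Φ z

namespace IsPosHomogeneous

variable {U : Set E} {k : ℕ} {Φ : E × V → W}

theorem fderiv_smul (h : IsPosHomogeneous U k Φ) (hU : IsOpen U) {z : E × V} (hz : z ∈ slit U)
    {t : ℝ} (ht : 0 < t) (u : E) (v : V) :
    fderiv ℝ Φ (z.1, t • z.2) (u, t • v) = t ^ k • fderiv ℝ Φ z (u, v) := by
  let scale : (E × V) ≃L[ℝ] E × V :=
    (ContinuousLinearEquiv.refl ℝ E).prodCongr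
      (ContinuousLinearEquiv.smulLeft (Units.mk0 t ht.ne'))
  have hscale : Φ ∘ scale =ᶠ[𝓝 z] t ^ k • Φ := by
    filter_upwards [(isOpen_slit hU).mem_nhds hz] with w hw using h w hw t ht
  have hderiv : (fderiv ℝ Φ (scale z)).comp (scale : (E × V) →L[ℝ] E × V) = t ^ k • fderiv ℝ Φ z :=
    by rw [← scale.comp_right_fderiv, hscale.fderiv_eq, fderiv_const_smul_field, Pi.smul_apply]
  exact DFunLike.congr_fun hderiv (u, v)

theorem fderiv_zero_snd (h : IsPosHomogeneous U k Φ) {z : E × V} (hz : z ∈ slit U)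
    (hΦ : DifferentiableAt ℝ Φ z) : fderiv ℝ Φ z (0, z.2) = (k : ℝ) • Φ z := by
  have hray : HasDerivAt (fun t : ℝ => (z.1, t • z.2)) (0, z.2) 1 := by
    simpa using (hasDerivAt_const (1 : ℝ) z.1).prodMk ((hasDerivAt_id (1 : ℝ)).smul_const z.2)
  have hchain : HasDerivAt (fun t : ℝ => Φ (z.1, t • z.2)) (fderiv ℝ Φ z (0, z.2)) 1 :=
    HasFDerivAt.comp_hasDerivAt (1 : ℝ) (by simpa using hΦ.hasFDerivAt) hray
  have hpow : HasDerivAt (fun t : ℝ => t ^ k • Φ z) ((k : ℝ) • Φ z) 1 := by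
    simpa using (hasDerivAt_pow k (1 : ℝ)).smul_const (Φ z)
  refine hchain.unique (hpow.congr_of_eventuallyEq ?_)
  filter_upwards [lt_mem_nhds zero_lt_one] with t ht using h z hz t ht

end IsPosHomogeneous

end Homogeneity

section PhaseSpace

/-- The coordinate domain `ℝⁿ × ℝⁿ ∋ (x, y)` of the tangent bundle. -/
abbrev PhaseSpace (n : ℕ) := EuclideanSpace ℝ (Fin n) × EuclideanSpace ℝ (Fin n)

variable {n : ℕ} {S : Set (PhaseSpace n)} {Φ : PhaseSpace n → ℝ}

theorem contDiffOn_pderivX (hS : IsOpen S) (hΦ : ContDiffOn ℝ ∞ Φ S) (i : Fin n) :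
    ContDiffOn ℝ ∞ (pderivX i Φ) S :=
  (hΦ.fderiv_of_isOpen hS (m := ∞) (by simp)).clm_apply contDiffOn_const

theorem contDiffOn_pderivY (hS : IsOpen S) (hΦ : ContDiffOn ℝ ∞ Φ S) (i : Fin n) :
    ContDiffOn ℝ ∞ (pderivY i Φ) S :=
  (hΦ.fderiv_of_isOpen hS (m := ∞) (by simp)).clm_apply contDiffOn_const

theorem fderiv_apply_eq_sum (z : PhaseSpace n) (u v : EuclideanSpace ℝ (Fin n)) :
    fderiv ℝ Φ z (u, v) = ∑ i, u i * pderivX i Φ z + ∑ i, v i * pderivY i Φ z := by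
  have hsum (w : EuclideanSpace ℝ (Fin n)) : ∑ i, w i • EuclideanSpace.single i (1 : ℝ) = w := by
    simpa using (EuclideanSpace.basisFun (Fin n) ℝ).sum_repr w
  have huv : (u, v) = ∑ i, u i • (EuclideanSpace.single i (1 : ℝ), 0)
      + ∑ i, v i • (0, EuclideanSpace.single i (1 : ℝ)) := by
    ext1
    · simp [Prod.fst_sum, hsum]
    · simp [Prod.snd_sum, hsum]
  simp only [huv, map_add, map_sum, map_smul, smul_eq_mul, pderivX, pderivY]

namespace IsPosHomogeneous

variable {U : Set (EuclideanSpace ℝ (Fin n))} {k : ℕ}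

theorem pderivX (h : IsPosHomogeneous U k Φ) (hU : IsOpen U) (i : Fin n) :
    IsPosHomogeneous U k (pderivX i Φ) := by
  intro z hz t ht
  have hderiv := h.fderiv_smul hU hz ht (EuclideanSpace.single i 1) 0
  rwa [smul_zero] at hderiv

theorem pderivY (h : IsPosHomogeneous U (k + 1) Φ) (hU : IsOpen U) (i : Fin n) :
    IsPosHomogeneous U k (pderivY i Φ) := by
  intro z hz t ht
  have hderiv := h.fderiv_smul hU hz ht 0 (EuclideanSpace.single i 1)
  rw [← smul_zero t, ← Prod.smul_mk, map_smul, pow_succ', mul_smul, smul_zero] at hderiv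
  exact smul_right_injective ℝ ht.ne' hderiv

theorem sum_mul_pderivY (h : IsPosHomogeneous U k Φ) {z : PhaseSpace n} (hz : z ∈ slit U)
    (hΦ : DifferentiableAt ℝ Φ z) : ∑ i, z.2 i * Finsler.pderivY i Φ z = k * Φ z := by
  simpa [fderiv_apply_eq_sum] using h.fderiv_zero_snd hz hΦ

end IsPosHomogeneous

end PhaseSpace

section LocalFinsler

variable {n : ℕ}

/-- A Finsler structure on the coordinate domain `U`, that is, the expression `F(x, y)` of a Finsler
structure in a chart with image `U`. Nothing but nonnegativity is required outside `slit U`. -/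
structure IsLocalFinsler (U : Set (EuclideanSpace ℝ (Fin n))) (F : PhaseSpace n → ℝ) : Prop where
  isOpen : IsOpen U
  nonneg : ∀ z, 0 ≤ F z
  contDiffOn : ContDiffOn ℝ ∞ F (slit U)
  homogeneous : IsPosHomogeneous U 1 F
  posDef : ∀ z ∈ slit U, (fundamentalTensor F z).PosDef

/-- The vertical part `-G` of the geodesic spray, so that the geodesic equation becomes
`x' = y`, `y' = sprayVector F (x, y)`. -/
def sprayVector (F : PhaseSpace n → ℝ) (z : PhaseSpace n) : EuclideanSpace ℝ (Fin n) :=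
  WithLp.toLp 2 fun i => -spray F i z

namespace IsLocalFinsler

variable {U : Set (EuclideanSpace ℝ (Fin n))} {F : PhaseSpace n → ℝ} {z : PhaseSpace n}

theorem isOpen_slit (hF : IsLocalFinsler U F) : IsOpen (slit U : Set (PhaseSpace n)) :=
  Finsler.isOpen_slit hF.isOpen

theorem contDiffOn_pderivX (hF : IsLocalFinsler U F) {Φ : PhaseSpace n → ℝ} (i : Fin n)
    (hΦ : ContDiffOn ℝ ∞ Φ (slit U)) : ContDiffOn ℝ ∞ (pderivX i Φ) (slit U) :=
  Finsler.contDiffOn_pderivX hF.isOpen_slit hΦ i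

theorem contDiffOn_pderivY (hF : IsLocalFinsler U F) {Φ : PhaseSpace n → ℝ} (i : Fin n)
    (hΦ : ContDiffOn ℝ ∞ Φ (slit U)) : ContDiffOn ℝ ∞ (pderivY i Φ) (slit U) :=
  Finsler.contDiffOn_pderivY hF.isOpen_slit hΦ i

theorem differentiableAt (hF : IsLocalFinsler U F) {Φ : PhaseSpace n → ℝ}
    (hΦ : ContDiffOn ℝ ∞ Φ (slit U)) (hz : z ∈ slit U) : DifferentiableAt ℝ Φ z :=
  (hΦ.contDiffAt (hF.isOpen_slit.mem_nhds hz)).differentiableAt (by simp)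

theorem contDiffOn_sq (hF : IsLocalFinsler U F) : ContDiffOn ℝ ∞ (fun w => F w ^ 2) (slit U) :=
  hF.contDiffOn.pow 2

theorem contDiffOn_half_sq (hF : IsLocalFinsler U F) :
    ContDiffOn ℝ ∞ (fun w => 1 / 2 * F w ^ 2) (slit U) :=
  contDiffOn_const.mul hF.contDiffOn_sq

theorem homogeneous_sq (hF : IsLocalFinsler U F) : IsPosHomogeneous U 2 (fun w => F w ^ 2) := by
  intro z hz t ht
  simp only [hF.homogeneous z hz t ht, smul_eq_mul]
  ring

theorem homogeneous_half_sq (hF : IsLocalFinsler U F) :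
    IsPosHomogeneous U 2 (fun w => 1 / 2 * F w ^ 2) := by
  intro z hz t ht
  simp only [hF.homogeneous z hz t ht, smul_eq_mul]
  ring

theorem fundamentalTensor_comm (hF : IsLocalFinsler U F) (hz : z ∈ slit U) (i j : Fin n) :
    fundamentalTensor F z i j = fundamentalTensor F z j i := by
  simpa using (hF.posDef z hz).1.apply j i

theorem isUnit_det_fundamentalTensor (hF : IsLocalFinsler U F) (hz : z ∈ slit U) :
    IsUnit (fundamentalTensor F z).det :=
  (hF.posDef z hz).det_pos.ne'.isUnit

theorem sum_mul_fundamentalTensor (hF : IsLocalFinsler U F) (hz : z ∈ slit U) (i : Fin n) :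
    ∑ j, z.2 j * fundamentalTensor F z i j = pderivY i (fun w => 1 / 2 * F w ^ 2) z := by
  have hsmooth := hF.contDiffOn_pderivY i hF.contDiffOn_half_sq
  simpa [fundamentalTensor] using
    (hF.homogeneous_half_sq.pderivY hF.isOpen i).sum_mul_pderivY hz (hF.differentiableAt hsmooth hz)

theorem sum_sum_fundamentalTensor (hF : IsLocalFinsler U F) (hz : z ∈ slit U) :
    ∑ i, ∑ j, fundamentalTensor F z i j * z.2 i * z.2 j = F z ^ 2 :=
  calc ∑ i, ∑ j, fundamentalTensor F z i j * z.2 i * z.2 j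
      = ∑ i, z.2 i * ∑ j, z.2 j * fundamentalTensor F z i j := by
        simp only [Finset.mul_sum]
        exact Finset.sum_congr rfl fun i _ => Finset.sum_congr rfl fun j _ => by ring
    _ = ∑ i, z.2 i * pderivY i (fun w => 1 / 2 * F w ^ 2) z := by
        simp only [hF.sum_mul_fundamentalTensor hz]
    _ = F z ^ 2 := by
        rw [hF.homogeneous_half_sq.sum_mul_pderivY hz
          (hF.differentiableAt hF.contDiffOn_half_sq hz)]
        push_cast
        ring

theorem pos (hF : IsLocalFinsler U F) (hz : z ∈ slit U) : 0 < F z := by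
  have hquad : star z.2.ofLp ⬝ᵥ (fundamentalTensor F z).mulVec z.2.ofLp = F z ^ 2 := by
    rw [← hF.sum_sum_fundamentalTensor hz]
    simp only [dotProduct, Matrix.mulVec, Finset.mul_sum, star_trivial]
    exact Finset.sum_congr rfl fun i _ => Finset.sum_congr rfl fun j _ => by ring
  have hy : z.2.ofLp ≠ 0 := by simpa using hz.2
  have hsq : 0 < F z ^ 2 := hquad ▸ (hF.posDef z hz).dotProduct_mulVec_pos hy
  exact (hF.nonneg z).lt_of_ne' (pow_ne_zero_iff two_ne_zero |>.mp hsq.ne')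

theorem contDiffOn_spray (hF : IsLocalFinsler U F) (i : Fin n) :
    ContDiffOn ℝ ∞ (spray F i) (slit U) := by
  have hg (i j : Fin n) : ContDiffOn ℝ ∞ (fun z => fundamentalTensor F z i j) (slit U) :=
    hF.contDiffOn_pderivY j (hF.contDiffOn_pderivY i hF.contDiffOn_half_sq)
  refine contDiffOn_const.mul (ContDiffOn.sum fun l _ => ContDiffOn.mul ?_ (ContDiffOn.sub ?_ ?_))
  · exact contDiffOn_inv_apply hg (fun z hz => (hF.isUnit_det_fundamentalTensor hz).ne_zero) i l
  · exact ContDiffOn.sum fun k _ => (hF.contDiffOn_pderivY l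
      (hF.contDiffOn_pderivX k hF.contDiffOn_sq)).mul (by fun_prop)
  · exact hF.contDiffOn_pderivX l hF.contDiffOn_sq

theorem contDiffOn_riemannCurvature (hF : IsLocalFinsler U F) (i k : Fin n) :
    ContDiffOn ℝ ∞ (riemannCurvature F i k) (slit U) := by
  have hG := hF.contDiffOn_spray
  have hGx (i j : Fin n) := hF.contDiffOn_pderivX j (hG i)
  have hGy (i j : Fin n) := hF.contDiffOn_pderivY j (hG i)
  refine contDiffOn_const.mul (((contDiffOn_const.mul (hGx i k)).sub ?_ |>.sub ?_).add ?_)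
  · exact contDiffOn_const.mul (ContDiffOn.sum fun j _ => (hGy i j).mul (hGy j k))
  · exact ContDiffOn.sum fun j _ => ContDiffOn.mul (by fun_prop) (hF.contDiffOn_pderivX j (hGy i k))
  · exact ContDiffOn.sum fun j _ => (hG j).mul (hF.contDiffOn_pderivY j (hGy i k))

theorem contDiffOn_ricciTensor (hF : IsLocalFinsler U F) (i k : Fin n) :
    ContDiffOn ℝ ∞ (fun z => ricciTensor F z i k) (slit U) := by
  have hsum : ContDiffOn ℝ ∞ (fun w => ∑ j, riemannCurvature F j j w) (slit U) :=
    ContDiffOn.sum fun j _ => hF.contDiffOn_riemannCurvature j j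
  exact contDiffOn_const.mul (hF.contDiffOn_pderivY k (hF.contDiffOn_pderivY i hsum))

theorem pderivY_sq (hF : IsLocalFinsler U F) (hz : z ∈ slit U) (i : Fin n) :
    pderivY i (fun w => F w ^ 2) z = 2 * ∑ j, z.2 j * fundamentalTensor F z i j := by
  rw [hF.sum_mul_fundamentalTensor hz]
  unfold pderivY
  rw [fderiv_const_mul (hF.differentiableAt hF.contDiffOn_sq hz)]
  simp

theorem sum_fundamentalTensor_mul_spray (hF : IsLocalFinsler U F) (hz : z ∈ slit U) (j : Fin n) :
    ∑ i, fundamentalTensor F z j i * spray F i z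
      = 1 / 2 * ((∑ k, pderivY j (pderivX k fun w => F w ^ 2) z * z.2 k)
        - pderivX j (fun w => F w ^ 2) z) := by
  let b : Fin n → ℝ := fun l =>
    (∑ k, pderivY l (pderivX k fun w => F w ^ 2) z * z.2 k) - pderivX l (fun w => F w ^ 2) z
  have hspray : (fun i => spray F i z) = (1 / 2 : ℝ) • (fundamentalTensor F z)⁻¹.mulVec b := rfl
  change (fundamentalTensor F z).mulVec (fun i => spray F i z) j = 1 / 2 * b j
  rw [hspray, Matrix.mulVec_smul, Matrix.mulVec_mulVec,
    Matrix.mul_nonsing_inv _ (hF.isUnit_det_fundamentalTensor hz), Matrix.one_mulVec,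
    Pi.smul_apply, smul_eq_mul]

theorem sum_mul_sum_pderivY_pderivX_sq (hF : IsLocalFinsler U F) (hz : z ∈ slit U) :
    ∑ l, z.2 l * ∑ k, pderivY l (pderivX k fun w => F w ^ 2) z * z.2 k
      = 2 * ∑ k, z.2 k * pderivX k (fun w => F w ^ 2) z := by
  have heuler (k : Fin n) : ∑ l, z.2 l * pderivY l (pderivX k fun w => F w ^ 2) z
      = 2 * pderivX k (fun w => F w ^ 2) z := by
    simpa using (hF.homogeneous_sq.pderivX hF.isOpen k).sum_mul_pderivY hz
      (hF.differentiableAt (hF.contDiffOn_pderivX k hF.contDiffOn_sq) hz)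
  simp only [Finset.mul_sum]
  rw [Finset.sum_comm]
  refine Finset.sum_congr rfl fun k _ => ?_
  rw [mul_left_comm, ← heuler, Finset.mul_sum]
  exact Finset.sum_congr rfl fun l _ => by ring

theorem sum_spray_mul_pderivY_sq (hF : IsLocalFinsler U F) (hz : z ∈ slit U) :
    ∑ i, spray F i z * pderivY i (fun w => F w ^ 2) z
      = ∑ k, z.2 k * pderivX k (fun w => F w ^ 2) z :=
  calc ∑ i, spray F i z * pderivY i (fun w => F w ^ 2) z
      = ∑ i, ∑ j, 2 * z.2 j * (fundamentalTensor F z j i * spray F i z) := by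
        simp only [hF.pderivY_sq hz, Finset.mul_sum]
        refine Finset.sum_congr rfl fun i _ => Finset.sum_congr rfl fun j _ => ?_
        rw [hF.fundamentalTensor_comm hz i j]
        ring
    _ = ∑ j, 2 * z.2 j * ∑ i, fundamentalTensor F z j i * spray F i z := by
        simp only [Finset.mul_sum]
        exact Finset.sum_comm
    _ = (∑ j, z.2 j * ∑ k, pderivY j (pderivX k fun w => F w ^ 2) z * z.2 k)
        - ∑ k, z.2 k * pderivX k (fun w => F w ^ 2) z := by
        rw [← Finset.sum_sub_distrib]
        refine Finset.sum_congr rfl fun j _ => ?_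
        rw [hF.sum_fundamentalTensor_mul_spray hz]
        ring
    _ = ∑ k, z.2 k * pderivX k (fun w => F w ^ 2) z := by
        rw [hF.sum_mul_sum_pderivY_pderivX_sq hz]
        ring

theorem fderiv_sq_sprayVector (hF : IsLocalFinsler U F) (hz : z ∈ slit U) :
    fderiv ℝ (fun w => F w ^ 2) z (z.2, sprayVector F z) = 0 := by
  simp only [fderiv_apply_eq_sum, sprayVector, neg_mul, Finset.sum_neg_distrib,
    hF.sum_spray_mul_pderivY_sq hz, add_neg_cancel]

end IsLocalFinsler

end LocalFinsler

section Shooting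

open Metric Set Filter
open scoped NNReal

variable {W E : Type*} [NormedAddCommGroup W] [NormedSpace ℝ W]
  [NormedAddCommGroup E] [NormedSpace ℝ E]

theorem contDiffOn_of_forall_hasDerivAt [CompleteSpace W] {m : ℕ∞} {f : W → W} {S : Set W}
    (hf : ContDiffOn ℝ m f S) {α : ℝ → W} {J : Set ℝ} (hJ : IsOpen J) (hmem : MapsTo α J S)
    (hα : ∀ t ∈ J, HasDerivAt α (f (α t)) t) : ContDiffOn ℝ m α J := by
  intro t ht
  obtain ⟨δ, hδ, hδJ⟩ := nhds_basis_closedBall.mem_iff.1 (hJ.mem_nhds ht)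
  rw [Real.closedBall_eq_Icc] at hδJ
  have hsmooth : ContDiffOn ℝ m α (Icc (t - δ) (t + δ)) :=
    ODE.contDiffOn_enat_Icc_of_hasDerivWithinAt (f := fun _ => f)
      (hf.comp contDiffOn_snd fun z hz => hz.2)
      (fun s hs => (hα s (hδJ hs)).hasDerivWithinAt) (hmem.mono_left hδJ)
  exact (hsmooth.contDiffAt (Icc_mem_nhds (by linarith) (by linarith))).contDiffWithinAt

/-- `α` restricts to a flow of the vector field `f` that is defined for the initial points in the
ball of radius `r` around `w₀` and for the times in `(-ε, ε)`, and that stays in `S`. -/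
def IsLocalFlow (f : W → W) (S : Set W) (w₀ : W) (r ε : ℝ) (α : W → ℝ → W) : Prop :=
  ∀ w ∈ closedBall w₀ r, α w 0 = w ∧
    ∀ t ∈ Ioo (-ε) ε, α w t ∈ S ∧ HasDerivAt (α w) (f (α w t)) t

theorem exists_isLocalFlow [CompleteSpace W] {f : W → W} {w₀ : W} (hf : ContDiffAt ℝ 1 f w₀)
    {S : Set W} (hS : S ∈ 𝓝 w₀) :
    ∃ r > (0 : ℝ), ∃ ε > (0 : ℝ), ∃ L : ℝ≥0, ∃ α : W → ℝ → W, IsLocalFlow f S w₀ r ε α ∧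
      ∀ t ∈ Ioo (-ε) ε, LipschitzOnWith L (α · t) (closedBall w₀ r) := by
  obtain ⟨ε, hε, a, r, _, K, hr, hPL⟩ := IsPicardLindelof.of_contDiffAt_one hf
  obtain ⟨α, hα, L, hL⟩ := (hPL 0).exists_forall_mem_closedBall_eq_hasDerivWithinAt_lipschitzOnWith
  have hIcc : Icc (0 - ε) (0 + ε) ∈ 𝓝 (0 : ℝ) := Icc_mem_nhds (by linarith) (by linarith)
  have hcontOn : ContinuousOn (Function.uncurry α) (closedBall w₀ r ×ˢ Icc (0 - ε) (0 + ε)) :=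
    continuousOn_prod_of_continuousOn_lipschitzOnWith _ L
      (fun w hw t ht => ((hα w hw).2 t ht).continuousWithinAt) hL
  have hcont : ContinuousAt (Function.uncurry α) (w₀, 0) :=
    hcontOn.continuousAt (prod_mem_nhds (closedBall_mem_nhds w₀ hr) hIcc)
  have hα₀ : Function.uncurry α (w₀, 0) = w₀ := (hα w₀ (mem_closedBall_self r.2)).1
  have hmem : Function.uncurry α ⁻¹' S ∈ 𝓝 w₀ ×ˢ 𝓝 (0 : ℝ) := by
    rw [← nhds_prod_eq]
    exact hcont.preimage_mem_nhds (by rwa [hα₀])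
  obtain ⟨⟨r', ε'⟩, ⟨hr', hε'⟩, hS'⟩ :=
    (nhds_basis_closedBall.prod (nhds_basis_Ioo_pos (0 : ℝ))).mem_iff.1 hmem
  have hball : closedBall w₀ (min r r') ⊆ closedBall w₀ r :=
    closedBall_subset_closedBall (min_le_left _ _)
  have htime {t : ℝ} (ht : t ∈ Ioo (-min ε ε') (min ε ε')) :
      t ∈ Ioo (0 - ε) (0 + ε) ∧ t ∈ Ioo (0 - ε') (0 + ε') := by
    simp only [zero_sub, zero_add, mem_Ioo, ← abs_lt] at ht ⊢
    exact lt_min_iff.1 ht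
  refine ⟨min r r', lt_min hr hr', min ε ε', lt_min hε hε', L, α, fun w hw =>
    ⟨(hα w (hball hw)).1, fun t ht => ⟨?_, ?_⟩⟩, fun t ht => ?_⟩
  · exact @hS' (w, t) ⟨closedBall_subset_closedBall (min_le_right _ _) hw, (htime ht).2⟩
  · exact ((hα w (hball hw)).2 t (Ioo_subset_Icc_self (htime ht).1)).hasDerivAt
      (Icc_mem_nhds (htime ht).1.1 (htime ht).1.2)
  · exact (hL t (Ioo_subset_Icc_self (htime ht).1)).mono hball

theorem exists_isLocalFlow_acceleration [CompleteSpace W] {f : W → W} {w₀ : W}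
    (hf : ContDiffAt ℝ 2 f w₀) {S : Set W} (hS : S ∈ 𝓝 w₀) :
    ∃ r > (0 : ℝ), ∃ ε > (0 : ℝ), ∃ L : ℝ≥0, ∃ B : ℝ, ∃ α a : W → ℝ → W,
      IsLocalFlow f S w₀ r ε α ∧ ∀ t ∈ Ioo (-ε) ε,
        (∀ w ∈ closedBall w₀ r, HasDerivAt (fun s => f (α w s)) (a w t) t ∧ ‖a w t‖ ≤ B) ∧
        LipschitzOnWith L (a · t) (closedBall w₀ r) := by
  let k : W → W := fun w => fderiv ℝ f w (f w)
  have hf₁ : ContDiffAt ℝ 1 f w₀ := hf.of_le (by norm_num)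
  have hk : ContDiffAt ℝ 1 k w₀ := (hf.fderiv_right (m := 1) (by norm_num)).clm_apply hf₁
  obtain ⟨K, s, hs, hKs⟩ := hk.exists_lipschitzOnWith
  have hbound : ∀ᶠ w in 𝓝 w₀, ‖k w‖ < ‖k w₀‖ + 1 :=
    hk.continuousAt.norm.eventually_lt continuousAt_const (by linarith)
  have hdiff : ∀ᶠ w in 𝓝 w₀, DifferentiableAt ℝ f w :=
    (hf₁.eventually (by simp)).mono fun w hw => hw.differentiableAt (by simp)
  obtain ⟨r, hr, ε, hε, L, α, hα, hL⟩ :=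
    exists_isLocalFlow hf₁ (inter_mem hS (inter_mem hs (hbound.and hdiff)))
  refine ⟨r, hr, ε, hε, K * L, ‖k w₀‖ + 1, α, fun w t => k (α w t),
    fun w hw => ⟨(hα w hw).1, fun t ht => ((hα w hw).2 t ht).imp_left And.left⟩,
    fun t ht => ⟨fun w hw => ?_, hKs.comp (hL t ht) fun w hw => ((hα w hw).2 t ht).1.2.1⟩⟩
  obtain ⟨⟨-, -, hlt, hfd⟩, hderiv⟩ := (hα w hw).2 t ht
  exact ⟨hfd.hasFDerivAt.comp_hasDerivAt t hderiv, hlt.le⟩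

theorem norm_sub_sub_smul_le {P D K : ℝ → E} {T C : ℝ} (hT : 0 ≤ T)
    (hP : ∀ t ∈ Icc 0 T, HasDerivAt P (D t) t) (hD : ∀ t ∈ Icc 0 T, HasDerivAt D (K t) t)
    (hK : ∀ t ∈ Icc 0 T, ‖K t‖ ≤ C) : ‖P T - P 0 - T • D 0‖ ≤ C * T ^ 2 := by
  have hC : 0 ≤ C := (norm_nonneg _).trans (hK 0 ⟨le_rfl, hT⟩)
  have hvelocity : ∀ t ∈ Icc 0 T, ‖D t - D 0‖ ≤ C * T := fun t ht =>
    (norm_image_sub_le_of_norm_deriv_le_segment' (fun s hs => (hD s hs).hasDerivWithinAt)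
      (fun s hs => hK s ⟨hs.1, hs.2.le⟩) t ht).trans
      (mul_le_mul_of_nonneg_left (by linarith [ht.2]) hC)
  have hderiv : ∀ t ∈ Icc 0 T, HasDerivAt (fun t => P t - t • D 0) (D t - D 0) t := fun t ht => by
    simpa using (hP t ht).fun_sub ((hasDerivAt_id t).smul_const (D 0))
  have hbound := norm_image_sub_le_of_norm_deriv_le_segment'
    (fun s hs => (hderiv s hs).hasDerivWithinAt)
    (fun s hs => hvelocity s ⟨hs.1, hs.2.le⟩) T ⟨hT, le_rfl⟩
  calc ‖P T - P 0 - T • D 0‖ = ‖(P T - T • D 0) - (P 0 - (0 : ℝ) • D 0)‖ := by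
        congr 1
        simp only [zero_smul, sub_zero]
        abel
    _ ≤ C * T * (T - 0) := hbound
    _ = C * T ^ 2 := by ring

theorem surjOn_closedBall_of_approximatesLinearOn_smul_id [CompleteSpace E] {Φ : E → E} {T ρ : ℝ}
    {c : ℝ≥0} {y : E} (hT : 0 < T) (hρ : 0 ≤ ρ)
    (hΦ : ApproximatesLinearOn Φ (T • ContinuousLinearMap.id ℝ E) (closedBall y ρ) c) :
    SurjOn Φ (closedBall y ρ) (closedBall (Φ y) ((T - c) * ρ)) := by
  let inverse : (T • ContinuousLinearMap.id ℝ E).NonlinearRightInverse :=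
    { toFun := fun v => T⁻¹ • v
      nnnorm := ‖T⁻¹‖₊
      bound' := fun v => (norm_smul T⁻¹ v).le
      right_inv' := fun v => by simp [smul_smul, hT.ne'] }
  have hnorm : (inverse.nnnorm : ℝ)⁻¹ = T := by
    simp [inverse, abs_of_pos hT]
  simpa only [hnorm] using hΦ.surjOn_closedBall_of_nonlinearRightInverse inverse hρ subset_rfl

/-- Here `P v T = x₁ + T v + O(T²)` with a remainder that is Lipschitz in `v` with constant `A T²`,
so the endpoint map is a perturbation of `v ↦ x₁ + T v` for small `T`. -/
theorem surjOn_endpoint [CompleteSpace E] {P D K : E → ℝ → E} {x₁ y₀ : E} {T ρ B : ℝ} {A : ℝ≥0}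
    (hT : 0 < T) (hρ : 0 ≤ ρ) (hAT : A * T ≤ 1 / 2) (hBT : B * T ≤ ρ / 4)
    (hP : ∀ v ∈ closedBall y₀ ρ, P v 0 = x₁ ∧ ∀ t ∈ Icc 0 T, HasDerivAt (P v) (D v t) t)
    (hD : ∀ v ∈ closedBall y₀ ρ, D v 0 = v ∧ ∀ t ∈ Icc 0 T, HasDerivAt (D v) (K v t) t)
    (hK : ∀ t ∈ Icc 0 T, LipschitzOnWith A (K · t) (closedBall y₀ ρ))
    (hK₀ : ∀ t ∈ Icc 0 T, ‖K y₀ t‖ ≤ B) :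
    SurjOn (P · T) (closedBall y₀ ρ) (closedBall (x₁ + T • y₀) (T * ρ / 4)) := by
  have happrox : ApproximatesLinearOn (P · T) (T • ContinuousLinearMap.id ℝ E) (closedBall y₀ ρ)
      (A * Real.toNNReal (T ^ 2)) := by
    intro v hv w hw
    have hdiff := norm_sub_sub_smul_le hT.le
      (fun t ht => ((hP v hv).2 t ht).fun_sub ((hP w hw).2 t ht))
      (fun t ht => ((hD v hv).2 t ht).fun_sub ((hD w hw).2 t ht))
      (fun t ht => (hK t ht).norm_sub_le hv hw)
    simp only [(hP v hv).1, (hP w hw).1, (hD v hv).1, (hD w hw).1, sub_self, sub_zero] at hdiff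
    rw [NNReal.coe_mul, Real.coe_toNNReal _ (sq_nonneg T)]
    calc ‖P v T - P w T - T • (v - w)‖ ≤ A * ‖v - w‖ * T ^ 2 := hdiff
      _ = A * T ^ 2 * ‖v - w‖ := by ring
  have hy₀ : y₀ ∈ closedBall y₀ ρ := mem_closedBall_self hρ
  have hcenter : dist (x₁ + T • y₀) (P y₀ T) ≤ B * T ^ 2 := by
    have h := norm_sub_sub_smul_le hT.le (hP y₀ hy₀).2 (hD y₀ hy₀).2 hK₀
    rwa [(hP y₀ hy₀).1, (hD y₀ hy₀).1, sub_sub, ← dist_eq_norm, dist_comm] at h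
  refine (surjOn_closedBall_of_approximatesLinearOn_smul_id hT hρ happrox).mono subset_rfl
    (closedBall_subset_closedBall' ?_)
  rw [NNReal.coe_mul, Real.coe_toNNReal _ (sq_nonneg T)]
  have hquarter : B * T ^ 2 ≤ T * ρ / 4 := by nlinarith
  have hhalf : A * T ^ 2 * ρ ≤ T * ρ / 2 := by nlinarith [mul_nonneg hT.le hρ]
  linarith

theorem eventually_mul_lt_nhdsGT_zero (c : ℝ) {d : ℝ} (hd : 0 < d) :
    ∀ᶠ T in 𝓝[>] (0 : ℝ), c * T < d :=
  (tendsto_nhdsWithin_of_tendsto_nhds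
    ((continuous_const_mul c).tendsto' 0 0 (mul_zero c))).eventually_lt_const hd

theorem exists_forall_nhds_exists_endpoint_eq [CompleteSpace E] {P D K : E × E → ℝ → E}
    {x₀ y₀ : E} {ρ ε B : ℝ} {A : ℝ≥0} (hρ : 0 < ρ) (hε : 0 < ε)
    (hP : ∀ z ∈ closedBall (x₀, y₀) ρ, P z 0 = z.1 ∧ ∀ t ∈ Ioo (-ε) ε, HasDerivAt (P z) (D z t) t)
    (hD : ∀ z ∈ closedBall (x₀, y₀) ρ, D z 0 = z.2 ∧ ∀ t ∈ Ioo (-ε) ε, HasDerivAt (D z) (K z t) t)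
    (hK : ∀ t ∈ Ioo (-ε) ε, LipschitzOnWith A (K · t) (closedBall (x₀, y₀) ρ))
    (hKB : ∀ z ∈ closedBall (x₀, y₀) ρ, ∀ t ∈ Ioo (-ε) ε, ‖K z t‖ ≤ B) :
    ∃ T > (0 : ℝ), T < ε ∧ ∃ x₁ : E, ∀ᶠ x in 𝓝 x₀,
      ∃ v, (x₁, v) ∈ closedBall (x₀, y₀) ρ ∧ P (x₁, v) T = x := by
  obtain ⟨T, hT, hTε, hTρ, hAT, hBT⟩ := ((eventually_mem_nhdsWithin (a := (0 : ℝ))).and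
    ((eventually_mul_lt_nhdsGT_zero 1 hε).and ((eventually_mul_lt_nhdsGT_zero ‖y₀‖ hρ).and
      ((eventually_mul_lt_nhdsGT_zero ((A * 1 : ℝ≥0) : ℝ) one_half_pos).and
        (eventually_mul_lt_nhdsGT_zero B (show 0 < ρ / 4 by positivity)))))).exists
  rw [one_mul] at hTε
  rw [mem_Ioi] at hT
  obtain ⟨x₁, rfl⟩ : ∃ x₁, x₁ + T • y₀ = x₀ := ⟨x₀ - T • y₀, sub_add_cancel _ _⟩
  have hdist : dist x₁ (x₁ + T • y₀) ≤ ρ := by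
    rw [dist_self_add_right, norm_smul, Real.norm_of_nonneg hT.le, mul_comm]
    exact hTρ.le
  have hmem : MapsTo (Prod.mk x₁) (closedBall y₀ ρ) (closedBall (x₁ + T • y₀, y₀) ρ) :=
    fun v hv => by
      rw [mem_closedBall, Prod.dist_eq]
      exact max_le hdist hv
  have hIcc : Icc 0 T ⊆ Ioo (-ε) ε := fun t ht => ⟨by linarith [ht.1], by linarith [ht.2]⟩
  have hsurj := surjOn_endpoint hT hρ.le hAT.le hBT.le
    (fun v hv => (hP _ (hmem hv)).imp_right fun h t ht => h t (hIcc ht))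
    (fun v hv => (hD _ (hmem hv)).imp_right fun h t ht => h t (hIcc ht))
    (fun t ht => (hK t (hIcc ht)).comp (LipschitzWith.prodMk_left x₁).lipschitzOnWith hmem)
    (fun t ht => hKB _ (hmem (mem_closedBall_self hρ.le)) t (hIcc ht))
  refine ⟨T, hT, hTε, x₁, ?_⟩
  filter_upwards [closedBall_mem_nhds (x₁ + T • y₀) (show 0 < T * ρ / 4 by positivity)] with x hx
  obtain ⟨v, hv, hvx⟩ := hsurj hx
  exact ⟨v, hmem hv, hvx⟩

theorem exists_shooting [CompleteSpace W] [CompleteSpace E] {f : W → W} {S : Set W}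
    (π : W →L[ℝ] E) {x₀ y₀ : E} {ι : E × E → W} {N : Set (E × E)} (hN : N ∈ 𝓝 (x₀, y₀))
    (hι : ContDiffAt ℝ 1 ι (x₀, y₀)) (hf : ContDiffAt ℝ 2 f (ι (x₀, y₀)))
    (hS : S ∈ 𝓝 (ι (x₀, y₀))) (hpos : ∀ z ∈ N, π (ι z) = z.1) (hvel : ∀ z ∈ N, π (f (ι z)) = z.2) :
    ∃ T > (0 : ℝ), ∃ ε > T, ∃ x₁ : E, ∀ᶠ x in 𝓝 x₀, ∃ α : ℝ → W, α 0 ∈ ι '' N ∧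
      π (α 0) = x₁ ∧ π (α T) = x ∧ ∀ t ∈ Ioo (-ε) ε, α t ∈ S ∧ HasDerivAt α (f (α t)) t := by
  obtain ⟨r, hr, ε, hε, L, B, α, a, hα, ha⟩ := exists_isLocalFlow_acceleration hf hS
  obtain ⟨Lι, s, hs, hιs⟩ := hι.exists_lipschitzOnWith
  have hball : ι ⁻¹' closedBall (ι (x₀, y₀)) r ∈ 𝓝 (x₀, y₀) :=
    hι.continuousAt.preimage_mem_nhds (closedBall_mem_nhds _ hr)
  obtain ⟨ρ, hρ, hρN⟩ := nhds_basis_closedBall.mem_iff.1 (inter_mem hN (inter_mem hs hball))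
  have hα₀ : ∀ z ∈ closedBall (x₀, y₀) ρ, α (ι z) 0 = ι z := fun z hz => (hα _ (hρN hz).2.2).1
  obtain ⟨T, hT, hTε, x₁, hx₁⟩ := exists_forall_nhds_exists_endpoint_eq hρ hε
    (P := fun z t => π (α (ι z) t)) (D := fun z t => π (f (α (ι z) t)))
    (K := fun z t => π (a (ι z) t))
    (fun z hz => ⟨by rw [hα₀ z hz, hpos z (hρN hz).1], fun t ht =>
      π.hasFDerivAt.comp_hasDerivAt t ((hα _ (hρN hz).2.2).2 t ht).2⟩)
    (fun z hz => ⟨by rw [hα₀ z hz, hvel z (hρN hz).1], fun t ht =>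
      π.hasFDerivAt.comp_hasDerivAt t ((ha t ht).1 _ (hρN hz).2.2).1⟩)
    (fun t ht => π.lipschitz.comp_lipschitzOnWith ((ha t ht).2.comp
      (hιs.mono fun z hz => (hρN hz).2.1) fun z hz => (hρN hz).2.2))
    (fun z hz t ht => (π.le_opNorm _).trans
      (mul_le_mul_of_nonneg_left ((ha t ht).1 _ (hρN hz).2.2).2 (norm_nonneg π)))
  refine ⟨T, hT, ε, hTε, x₁, hx₁.mono fun x ⟨v, hv, hvx⟩ =>
    ⟨α (ι (x₁, v)), ⟨(x₁, v), (hρN hv).1, (hα₀ _ hv).symm⟩, ?_, hvx, (hα _ (hρN hv).2.2).2⟩⟩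
  rw [hα₀ _ hv, hpos _ (hρN hv).1]

theorem hasDerivAt_fst {f : ℝ → W × E} {f' : W × E} {t : ℝ} (hf : HasDerivAt f f' t) :
    HasDerivAt (fun t => (f t).1) f'.1 t :=
  (ContinuousLinearMap.fst ℝ W E).hasFDerivAt.comp_hasDerivAt t hf

theorem hasDerivAt_snd {f : ℝ → W × E} {f' : W × E} {t : ℝ} (hf : HasDerivAt f f' t) :
    HasDerivAt (fun t => (f t).2) f'.2 t :=
  (ContinuousLinearMap.snd ℝ W E).hasFDerivAt.comp_hasDerivAt t hf

theorem hasDerivAt_snd_comp_inv_mul {f : W → W} {α : ℝ → ℝ × W} {ε : ℝ}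
    (hpos : 0 < (α 0).1)
    (hα : ∀ t ∈ Ioo (-ε) ε, HasDerivAt α (0, (α t).1 • f (α t).2) t) {s : ℝ}
    (hs : (α 0).1⁻¹ * s ∈ Ioo (-ε) ε) :
    HasDerivAt (fun s => (α ((α 0).1⁻¹ * s)).2) (f (α ((α 0).1⁻¹ * s)).2) s := by
  have hε : (0 : ℝ) ∈ Ioo (-ε) ε := by
    have := hs.1.trans hs.2
    constructor <;> linarith
  have hfst (t) (ht : t ∈ Ioo (-ε) ε) : HasDerivAt (fun t => (α t).1) 0 t :=
    hasDerivAt_fst (hα t ht)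
  have hconst (t) (ht : t ∈ Ioo (-ε) ε) : (α t).1 = (α 0).1 :=
    isOpen_Ioo.is_const_of_deriv_eq_zero isPreconnected_Ioo
      (fun t ht => (hfst t ht).differentiableAt.differentiableWithinAt)
      (fun t ht => (hfst t ht).deriv) ht hε
  have hsnd := hasDerivAt_snd (hα _ hs)
  simp only [hconst _ hs] at hsnd
  have hscale : HasDerivAt (fun s => (α 0).1⁻¹ * s) (α 0).1⁻¹ s := by
    simpa using (hasDerivAt_id s).const_mul (α 0).1⁻¹
  simpa [Function.comp_def, smul_smul, hpos.ne'] using hsnd.scomp s hscale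

/-- The initial velocities are prescribed only up to the factor `σ`: it is carried along as an
additional constant component of the state, and then absorbed in the parametrization. -/
theorem exists_shooting_rescaled [CompleteSpace W] [CompleteSpace E] {f : W → W} {S : Set W}
    (π : W →L[ℝ] E) {x₀ y₀ : E} {ι : E × E → W} {σ : E × E → ℝ} {N : Set (E × E)}
    (hN : N ∈ 𝓝 (x₀, y₀)) (hι : ContDiffAt ℝ 1 ι (x₀, y₀)) (hσ : ContDiffAt ℝ 1 σ (x₀, y₀))
    (hf : ContDiffAt ℝ 2 f (ι (x₀, y₀))) (hS : S ∈ 𝓝 (ι (x₀, y₀))) (hpos : ∀ z ∈ N, π (ι z) = z.1)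
    (hσpos : ∀ z ∈ N, 0 < σ z) (hvel : ∀ z ∈ N, σ z • π (f (ι z)) = z.2) :
    ∃ x₁ : E, ∀ᶠ x in 𝓝 x₀, ∃ T > (0 : ℝ), ∃ ε > T, ∃ α : ℝ → W, α 0 ∈ ι '' N ∧
      π (α 0) = x₁ ∧ π (α T) = x ∧ ∀ t ∈ Ioo (-ε) ε, α t ∈ S ∧ HasDerivAt α (f (α t)) t := by
  obtain ⟨T, hT, ε, hTε, x₁, hx₁⟩ := exists_shooting (f := fun w : ℝ × W => (0, w.1 • f w.2))
    (S := Prod.snd ⁻¹' S) (ι := fun z => (σ z, ι z)) (π.comp (ContinuousLinearMap.snd ℝ ℝ W))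
    hN (hσ.prodMk hι)
    (contDiffAt_const.prodMk (contDiffAt_fst.smul (ContDiffAt.comp _ hf contDiffAt_snd)))
    (continuousAt_snd.preimage_mem_nhds hS) hpos fun z hz => by simpa using hvel z hz
  refine ⟨x₁, hx₁.mono fun x ⟨α, ⟨z, hz, hz₀⟩, hα₀, hαT, hα⟩ => ?_⟩
  have hσz : (α 0).1 = σ z := by rw [← hz₀]
  have hσ₀ : 0 < (α 0).1 := hσz ▸ hσpos z hz
  have htime {s : ℝ} (hs : s ∈ Ioo (-((α 0).1 * ε)) ((α 0).1 * ε)) :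
      (α 0).1⁻¹ * s ∈ Ioo (-ε) ε := by
    rw [mem_Ioo, ← abs_lt] at hs ⊢
    rwa [abs_mul, abs_of_pos (inv_pos.2 hσ₀), inv_mul_lt_iff₀ hσ₀]
  refine ⟨(α 0).1 * T, mul_pos hσ₀ hT, (α 0).1 * ε, mul_lt_mul_of_pos_left hTε hσ₀,
    fun s => (α ((α 0).1⁻¹ * s)).2, ⟨z, hz, by simp [← hz₀]⟩, by simpa using hα₀,
    by simpa [inv_mul_cancel_left₀ hσ₀.ne'] using hαT, fun s hs => ⟨(hα _ (htime hs)).1, ?_⟩⟩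
  exact hasDerivAt_snd_comp_inv_mul hσ₀ (fun t ht => (hα t ht).2) (htime hs)

end Shooting

section Arcs

open Set Filter

variable {n : ℕ} {U : Set (EuclideanSpace ℝ (Fin n))} {F : PhaseSpace n → ℝ}

/-- The right hand side `2/(n-1) Ric_{jk} yʲ yᵏ` of the equation of projective parameters. -/
def projectiveRHS (F : PhaseSpace n → ℝ) (z : PhaseSpace n) : ℝ :=
  2 / ((n : ℝ) - 1) * ∑ j, ∑ k, ricciTensor F z j k * z.2 j * z.2 k

/-- A unit speed geodesic `X`, in coordinates, with a projective parameter `p` that maps its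
interval of definition `J` onto `(-1, 1)`. -/
structure IsCoordProjectiveArc (U : Set (EuclideanSpace ℝ (Fin n))) (F : PhaseSpace n → ℝ)
    (J : Set ℝ) (X : ℝ → EuclideanSpace ℝ (Fin n)) (p : ℝ → ℝ) : Prop where
  isOpen : IsOpen J
  ordConnected : J.OrdConnected
  contDiffOn : ContDiffOn ℝ ∞ X J
  mem : ∀ s ∈ J, X s ∈ U
  unit_speed : ∀ s ∈ J, F (X s, deriv X s) = 1
  geodesic : ∀ s ∈ J, deriv (deriv X) s = sprayVector F (X s, deriv X s)
  contDiffOn_param : ContDiffOn ℝ ∞ p J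
  deriv_ne_zero : ∀ s ∈ J, deriv p s ≠ 0
  schwarzian_eq : ∀ s ∈ J, schwarzian p s = projectiveRHS F (X s, deriv X s)
  bijOn : BijOn p J (Ioo (-1) 1)

theorem hasDerivAt_deriv_of_isOpen {E : Type*} [NormedAddCommGroup E] [NormedSpace ℝ E]
    {f f' : ℝ → E} {f'' : E} {J : Set ℝ} (hJ : IsOpen J) (hf : ∀ s ∈ J, HasDerivAt f (f' s) s)
    {s : ℝ} (hs : s ∈ J) (hf' : HasDerivAt f' f'' s) : HasDerivAt (deriv f) f'' s :=
  hf'.congr_of_eventuallyEq <| by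
    filter_upwards [hJ.mem_nhds hs] with t ht using (hf t ht).deriv

theorem schwarzian_const_mul_add_const {c : ℝ} (hc : c ≠ 0) (d : ℝ) (p : ℝ → ℝ) :
    schwarzian (fun s => c * p s + d) = schwarzian p := by
  have hderiv : deriv (fun s => c * p s + d) = fun s => c * deriv p s := by
    funext s
    simp
  funext s
  simp [schwarzian, hderiv, mul_div_mul_left _ _ hc]

/-- Here `a = p''/p'` and `b = log p'`. -/
theorem schwarzian_eq_of_hasDerivAt {a b p q : ℝ → ℝ} {J : Set ℝ} (hJ : IsOpen J)
    (ha : ∀ s ∈ J, HasDerivAt a (q s + a s ^ 2 / 2) s) (hb : ∀ s ∈ J, HasDerivAt b (a s) s)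
    (hp : ∀ s ∈ J, HasDerivAt p (Real.exp (b s)) s) {s : ℝ} (hs : s ∈ J) :
    schwarzian p s = q s := by
  have hp₂ (s) (hs : s ∈ J) : HasDerivAt (deriv p) (Real.exp (b s) * a s) s :=
    hasDerivAt_deriv_of_isOpen hJ hp hs (hb s hs).exp
  have hp₃ := hasDerivAt_deriv_of_isOpen hJ hp₂ hs ((hb s hs).exp.fun_mul (ha s hs))
  rw [schwarzian, (hp s hs).deriv, (hp₂ s hs).deriv, hp₃.deriv]
  have := (Real.exp_pos (b s)).ne'
  field_simp
  ring

theorem schwarzian_neg (p : ℝ → ℝ) : schwarzian (fun s => -p s) = schwarzian p := by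
  simpa using schwarzian_const_mul_add_const (neg_ne_zero.2 one_ne_zero) 0 p

theorem bijOn_Ioo_of_strictMonoOn {p : ℝ → ℝ} {a b : ℝ} (hab : a ≤ b)
    (hcont : ContinuousOn p (Icc a b)) (hmono : StrictMonoOn p (Icc a b)) :
    BijOn p (Ioo a b) (Ioo (p a) (p b)) :=
  ⟨fun _ hs => ⟨hmono (left_mem_Icc.2 hab) (Ioo_subset_Icc_self hs) hs.1,
    hmono (Ioo_subset_Icc_self hs) (right_mem_Icc.2 hab) hs.2⟩,
    hmono.injOn.mono Ioo_subset_Icc_self, intermediate_value_Ioo hab hcont⟩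

theorem exists_bijOn_affine_Ioo {a b : ℝ} (hab : a < b) :
    ∃ c > 0, ∃ d, BijOn (fun u => c * u + d) (Ioo a b) (Ioo (-1) 1) := by
  have hlen : 0 < b - a := sub_pos.2 hab
  refine ⟨2 / (b - a), by positivity, -(a + b) / (b - a), ?_⟩
  have himage := image_affine_Ioo (a := 2 / (b - a)) (by positivity) (-(a + b) / (b - a)) a b
  have hleft : 2 / (b - a) * a + -(a + b) / (b - a) = -1 := by
    field_simp
    ring
  have hright : 2 / (b - a) * b + -(a + b) / (b - a) = 1 := by
    field_simp
    ring
  rw [hleft, hright] at himage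
  rw [← himage]
  refine InjOn.bijOn_image fun u _ v _ huv => ?_
  simpa [hlen.ne'] using huv

namespace IsLocalFinsler

theorem contDiffOn_projectiveRHS (hF : IsLocalFinsler U F) :
    ContDiffOn ℝ ∞ (projectiveRHS F) (slit U) := by
  have hy (j : Fin n) : ContDiff ℝ ∞ fun z : PhaseSpace n => z.2 j := by fun_prop
  exact contDiffOn_const.mul (ContDiffOn.sum fun j _ => ContDiffOn.sum fun k _ =>
    ((hF.contDiffOn_ricciTensor j k).mul (hy j).contDiffOn).mul (hy k).contDiffOn)

theorem contDiffOn_sprayVector (hF : IsLocalFinsler U F) :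
    ContDiffOn ℝ ∞ (sprayVector F) (slit U) :=
  contDiffOn_euclidean.2 fun i => (hF.contDiffOn_spray i).neg

theorem apply_eq_of_hasDerivAt (hF : IsLocalFinsler U F) {z : ℝ → PhaseSpace n} {J : Set ℝ}
    (hJ : IsOpen J) (hJ' : IsPreconnected J) (hmem : ∀ s ∈ J, z s ∈ slit U)
    (hz : ∀ s ∈ J, HasDerivAt z ((z s).2, sprayVector F (z s)) s) {s t : ℝ} (hs : s ∈ J)
    (ht : t ∈ J) : F (z s) = F (z t) := by
  have hderiv (s) (hs : s ∈ J) : HasDerivAt (fun s => F (z s) ^ 2) 0 s := by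
    rw [← hF.fderiv_sq_sprayVector (hmem s hs)]
    exact (hF.differentiableAt hF.contDiffOn_sq (hmem s hs)).hasFDerivAt.comp_hasDerivAt s (hz s hs)
  exact (sq_eq_sq₀ (hF.nonneg _) (hF.nonneg _)).1 <| hJ.is_const_of_deriv_eq_zero hJ'
    (fun s hs => (hderiv s hs).differentiableAt.differentiableWithinAt)
    (fun s hs => (hderiv s hs).deriv) hs ht

end IsLocalFinsler

/-- The state space of the first order system for geodesics with projective parameter: position
and velocity, `p''/p'`, `log p'` and `p`. -/
abbrev ArcState (n : ℕ) := PhaseSpace n × ℝ × ℝ × ℝ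

/-- The vector field on `ArcState n` that governs geodesics with projective parameter. -/
def arcField (F : PhaseSpace n → ℝ) (w : ArcState n) : ArcState n :=
  ((w.1.2, sprayVector F w.1), projectiveRHS F w.1 + w.2.1 ^ 2 / 2, w.2.1, Real.exp w.2.2.1)

/-- The initial state of a geodesic from `z.1` in the direction of `z.2`, with unit speed. -/
def arcInit (F : PhaseSpace n → ℝ) (z : PhaseSpace n) : ArcState n :=
  ((z.1, (F z)⁻¹ • z.2), 0, 0, 0)

namespace IsLocalFinsler

theorem contDiffOn_arcField (hF : IsLocalFinsler U F) :
    ContDiffOn ℝ ∞ (arcField F) (Prod.fst ⁻¹' slit U) := by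
  have hspray := hF.contDiffOn_sprayVector.comp
    (contDiffOn_fst (F := ℝ × ℝ × ℝ)) (mapsTo_preimage _ _)
  have hRHS := hF.contDiffOn_projectiveRHS.comp
    (contDiffOn_fst (F := ℝ × ℝ × ℝ)) (mapsTo_preimage _ _)
  have hvelocity : ContDiff ℝ ∞ fun w : ArcState n => w.1.2 := by fun_prop
  have hsq : ContDiff ℝ ∞ fun w : ArcState n => w.2.1 ^ 2 / 2 := by fun_prop
  have hparam : ContDiff ℝ ∞ fun w : ArcState n => (w.2.1, Real.exp w.2.2.1) := by fun_prop
  exact (hvelocity.contDiffOn.prodMk hspray).prodMk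
    ((hRHS.add hsq.contDiffOn).prodMk hparam.contDiffOn)

theorem contDiffAt_arcInit (hF : IsLocalFinsler U F) {z : PhaseSpace n} (hz : z ∈ slit U) :
    ContDiffAt ℝ ∞ (arcInit F) z :=
  (contDiffAt_fst.prodMk (((hF.contDiffOn.contDiffAt (hF.isOpen_slit.mem_nhds hz)).inv
    (hF.pos hz).ne').smul contDiffAt_snd)).prodMk contDiffAt_const

theorem arcInit_mem (hF : IsLocalFinsler U F) {z : PhaseSpace n} (hz : z ∈ slit U) :
    (arcInit F z).1 ∈ slit U :=
  ⟨hz.1, smul_ne_zero (inv_ne_zero (hF.pos hz).ne') hz.2⟩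

theorem apply_arcInit (hF : IsLocalFinsler U F) {z : PhaseSpace n} (hz : z ∈ slit U) :
    F (arcInit F z).1 = 1 := by
  have hpos := hF.pos hz
  simpa [arcInit, hpos.ne'] using hF.homogeneous z hz _ (inv_pos.2 hpos)

theorem exists_isCoordProjectiveArc (hF : IsLocalFinsler U F) {w : ℝ → ArcState n} {δ ε : ℝ}
    (hδ : 0 < δ) (hδε : δ < ε) (hmem : ∀ s ∈ Ioo (-ε) ε, (w s).1 ∈ slit U)
    (hw : ∀ s ∈ Ioo (-ε) ε, HasDerivAt w (arcField F (w s)) s) (hunit : F (w 0).1 = 1) :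
    ∃ P, IsCoordProjectiveArc U F (Ioo (-δ) δ) (fun s => (w s).1.1) P := by
  have hz (s) (hs : s ∈ Ioo (-ε) ε) := hasDerivAt_fst (hw s hs)
  have ha (s) (hs : s ∈ Ioo (-ε) ε) := hasDerivAt_fst (hasDerivAt_snd (hw s hs))
  have hb (s) (hs : s ∈ Ioo (-ε) ε) := hasDerivAt_fst (hasDerivAt_snd (hasDerivAt_snd (hw s hs)))
  have hp (s) (hs : s ∈ Ioo (-ε) ε) := hasDerivAt_snd (hasDerivAt_snd (hasDerivAt_snd (hw s hs)))
  have hX (s) (hs : s ∈ Ioo (-ε) ε) := hasDerivAt_fst (hz s hs)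
  have hsmooth : ContDiffOn ℝ ∞ w (Ioo (-ε) ε) :=
    contDiffOn_of_forall_hasDerivAt hF.contDiffOn_arcField isOpen_Ioo hmem hw
  have hsub : Icc (-δ) δ ⊆ Ioo (-ε) ε := Icc_subset_Ioo (by linarith) hδε
  have hsub' : Ioo (-δ) δ ⊆ Ioo (-ε) ε := Ioo_subset_Icc_self.trans hsub
  have hcont : ContinuousOn (fun s => (w s).2.2.2) (Icc (-δ) δ) := fun s hs =>
    (hp s (hsub hs)).continuousAt.continuousWithinAt
  have hmono : StrictMonoOn (fun s => (w s).2.2.2) (Icc (-δ) δ) :=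
    strictMonoOn_of_deriv_pos (convex_Icc _ _) hcont fun s hs =>
      (hp s (hsub (interior_subset hs))).deriv ▸ Real.exp_pos _
  have hδ' : -δ < δ := by linarith
  obtain ⟨c, hc, d, hcd⟩ := exists_bijOn_affine_Ioo
    (hmono (left_mem_Icc.2 hδ'.le) (right_mem_Icc.2 hδ'.le) hδ')
  refine ⟨fun s => c * (w s).2.2.2 + d, isOpen_Ioo, ordConnected_Ioo,
    (contDiff_fst.fst.comp_contDiffOn hsmooth).mono hsub', fun s hs => (hmem s (hsub' hs)).1,
    fun s hs => ?_, fun s hs => ?_, ?_, fun s hs => ?_, fun s hs => ?_,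
    hcd.comp (bijOn_Ioo_of_strictMonoOn hδ'.le hcont hmono)⟩
  · rw [(hX s (hsub' hs)).deriv, ← hunit]
    exact hF.apply_eq_of_hasDerivAt isOpen_Ioo isPreconnected_Ioo hmem hz (hsub' hs)
      (hsub ⟨by linarith, hδ.le⟩)
  · rw [(hX s (hsub' hs)).deriv]
    exact (hasDerivAt_deriv_of_isOpen isOpen_Ioo hX (hsub' hs)
      (hasDerivAt_snd (hz s (hsub' hs)))).deriv
  · exact (contDiffOn_const.mul (contDiff_snd.snd.snd.comp_contDiffOn (hsmooth.mono hsub'))).add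
      contDiffOn_const
  · rw [(((hp s (hsub' hs)).const_mul c).add_const d).deriv]
    exact (mul_pos hc (Real.exp_pos _)).ne'
  · rw [schwarzian_const_mul_add_const hc.ne', (hX s (hsub' hs)).deriv]
    exact schwarzian_eq_of_hasDerivAt (q := fun s => projectiveRHS F (w s).1) isOpen_Ioo ha hb hp
      (hsub' hs)

theorem exists_eventually_isCoordProjectiveArc (hF : IsLocalFinsler U F) (hn : 0 < n)
    {x₀ : EuclideanSpace ℝ (Fin n)} (hx₀ : x₀ ∈ U) :
    ∃ x₁, ∀ᶠ x in 𝓝 x₀, ∃ J X P, IsCoordProjectiveArc U F J X P ∧ x₁ ∈ X '' J ∧ x ∈ X '' J := by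
  let y₀ : EuclideanSpace ℝ (Fin n) := EuclideanSpace.single ⟨0, hn⟩ 1
  have hz₀ : (x₀, y₀) ∈ slit U := ⟨hx₀, by simp [y₀]⟩
  have hN : slit U ∈ 𝓝 (x₀, y₀) := hF.isOpen_slit.mem_nhds hz₀
  have hS : Prod.fst ⁻¹' slit U ∈ 𝓝 (arcInit F (x₀, y₀)) :=
    continuousAt_fst.preimage_mem_nhds (hF.isOpen_slit.mem_nhds (hF.arcInit_mem hz₀))
  let position : ArcState n →L[ℝ] EuclideanSpace ℝ (Fin n) :=
    (ContinuousLinearMap.fst ℝ _ _).comp (ContinuousLinearMap.fst ℝ _ _)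
  obtain ⟨x₁, hx₁⟩ := exists_shooting_rescaled (f := arcField F) (σ := F) position hN
    ((hF.contDiffAt_arcInit hz₀).of_le (by simp)) ((hF.contDiffOn.contDiffAt hN).of_le (by simp))
    ((hF.contDiffOn_arcField.contDiffAt hS).of_le ENat.LEInfty.out) hS (fun z _ => rfl)
    (fun z => hF.pos) (fun z hz => smul_inv_smul₀ (hF.pos hz).ne' z.2)
  refine ⟨x₁, hx₁.mono ?_⟩
  rintro x ⟨T, hT, ε, hTε, w, ⟨z, hz, hwz⟩, h₁, hx, hw⟩
  obtain ⟨δ, hTδ, hδε⟩ := exists_between hTε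
  obtain ⟨P, hP⟩ := hF.exists_isCoordProjectiveArc (hT.trans hTδ) hδε (fun s hs => (hw s hs).1)
    (fun s hs => (hw s hs).2) (hwz ▸ hF.apply_arcInit hz)
  exact ⟨_, _, P, hP, ⟨0, ⟨by linarith, by linarith⟩, h₁⟩, ⟨T, ⟨by linarith, hTδ⟩, hx⟩⟩

end IsLocalFinsler

end Arcs

section Charts

open Set Filter Bundle

theorem eventuallyEq_symm_comp_comp {X H M : Type*} [TopologicalSpace X] [TopologicalSpace H]
    [TopologicalSpace M] (e : OpenPartialHomeomorph M H) {γ : X → M} {s : X}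
    (hγ : ContinuousAt γ s) (hs : γ s ∈ e.source) : γ =ᶠ[𝓝 s] e.symm ∘ e ∘ γ := by
  filter_upwards [hγ.preimage_mem_nhds (e.open_source.mem_nhds hs)] with t ht
    using (e.left_inv ht).symm

variable {E M : Type*} [NormedAddCommGroup E] [NormedSpace ℝ E] [TopologicalSpace M]
  [ChartedSpace E M] {e : OpenPartialHomeomorph M E}

theorem contMDiff_tangentBundle_mk : ContMDiff 𝓘(ℝ, E × E) 𝓘(ℝ, E).tangent ∞
    (fun z : E × E => (⟨z.1, z.2⟩ : TangentBundle 𝓘(ℝ, E) E)) := by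
  intro z
  rw [Bundle.contMDiffAt_totalSpace]
  refine ⟨contDiff_fst.contMDiff.contMDiffAt, ?_⟩
  simp only [trivializationAt_model_space_apply]
  exact contDiff_snd.contMDiff.contMDiffAt

theorem mdifferentiable_of_mem_maximalAtlas (he : e ∈ IsManifold.maximalAtlas 𝓘(ℝ, E) ∞ M) :
    e.MDifferentiable 𝓘(ℝ, E) 𝓘(ℝ, E) :=
  ⟨(contMDiffOn_of_mem_maximalAtlas he).mdifferentiableOn (by simp),
    (contMDiffOn_symm_of_mem_maximalAtlas he).mdifferentiableOn (by simp)⟩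

theorem contMDiffOn_tangentMap_symm [IsManifold 𝓘(ℝ, E) ∞ M]
    (he : e ∈ IsManifold.maximalAtlas 𝓘(ℝ, E) ∞ M) :
    ContMDiffOn 𝓘(ℝ, E × E) 𝓘(ℝ, E).tangent ∞
      (fun z : E × E => tangentMap 𝓘(ℝ, E) 𝓘(ℝ, E) e.symm ⟨z.1, z.2⟩)
      (Prod.fst ⁻¹' e.target) := by
  have : IsManifold 𝓘(ℝ, E) 1 M := .of_le (n := ∞) (by simp)
  have hsymm := (contMDiffOn_symm_of_mem_maximalAtlas he).contMDiffOn_tangentMapWithin (m := ∞)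
    (by simp) e.open_target.uniqueMDiffOn
  refine (hsymm.comp contMDiff_tangentBundle_mk.contMDiffOn fun z hz => hz).congr fun z hz => ?_
  simp only [Function.comp, tangentMap, tangentMapWithin,
    mfderivWithin_of_isOpen e.open_target hz]

theorem differentiableAt_chart_comp (he : e ∈ IsManifold.maximalAtlas 𝓘(ℝ, E) ∞ M) {γ : ℝ → M}
    {s : ℝ} (hγ : MDifferentiableAt 𝓘(ℝ, ℝ) 𝓘(ℝ, E) γ s) (hs : γ s ∈ e.source) :
    DifferentiableAt ℝ (e ∘ γ) s :=
  (((mdifferentiable_of_mem_maximalAtlas he).mdifferentiableAt hs).comp s hγ).differentiableAt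

/-- The velocity of a curve, as an element of the tangent bundle. -/
def velocity (γ : ℝ → M) (s : ℝ) : TangentBundle 𝓘(ℝ, E) M :=
  tangentMap 𝓘(ℝ, ℝ) 𝓘(ℝ, E) γ ⟨s, (1 : ℝ)⟩

theorem velocity_congr {γ γ' : ℝ → M} {s : ℝ} (h : γ =ᶠ[𝓝 s] γ') :
    velocity (E := E) γ s = velocity γ' s := by
  refine TotalSpace.ext h.eq_of_nhds (heq_of_eq ?_)
  exact congrArg (fun A : ℝ →L[ℝ] E => A 1) (h.mfderiv_eq (I := 𝓘(ℝ, ℝ)) (I' := 𝓘(ℝ, E)))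

theorem velocity_symm_comp (he : e ∈ IsManifold.maximalAtlas 𝓘(ℝ, E) ∞ M) {X : ℝ → E} {s : ℝ}
    (hX : DifferentiableAt ℝ X s) (hs : X s ∈ e.target) :
    velocity (e.symm ∘ X) s = tangentMap 𝓘(ℝ, E) 𝓘(ℝ, E) e.symm ⟨X s, deriv X s⟩ := by
  have hchain := tangentMap_comp_at ⟨s, (1 : ℝ)⟩
    ((mdifferentiable_of_mem_maximalAtlas he).mdifferentiableAt_symm hs) hX.mdifferentiableAt
  rw [velocity, hchain]
  refine congrArg _ (TotalSpace.ext rfl (heq_of_eq ?_))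
  exact congrArg (fun A : ℝ →L[ℝ] E => A 1) (mfderiv_eq_fderiv (f := X) (x := s))

end Charts

section FinslerCharts

open Set

variable {n : ℕ} {M : Type*} [TopologicalSpace M] [ChartedSpace (EuclideanSpace ℝ (Fin n)) M]
  [IsManifold (𝓡 n) ∞ M] {e : OpenPartialHomeomorph M (EuclideanSpace ℝ (Fin n))}

namespace FinslerStructure

theorem isLocalFinsler (F : FinslerStructure n M) (he : e ∈ IsManifold.maximalAtlas (𝓡 n) ∞ M) :
    IsLocalFinsler e.target (inChart F.toFun e) where
  isOpen := e.open_target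
  nonneg _ := F.nonneg _
  contDiffOn := by
    rw [← contMDiffOn_iff_contDiffOn]
    refine F.smooth.comp ((contMDiffOn_tangentMap_symm he).mono fun z hz => hz.1)
      fun z hz hzero => hz.2 ?_
    exact (mdifferentiable_of_mem_maximalAtlas he).symm.mfderiv_injective hz.1
      (hzero.trans (map_zero (mfderiv (𝓡 n) (𝓡 n) e.symm z.1)).symm)
  homogeneous z _ t ht := by
    simp only [inChart, pow_one, smul_eq_mul]
    rw [← F.homogeneous _ _ t ht]
    congr 2
    exact map_smul _ _ _
  posDef z hz := F.strongly_convex e he z.1 hz.1 z.2 hz.2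

theorem toFun_velocity (F : FinslerStructure n M) (he : e ∈ IsManifold.maximalAtlas (𝓡 n) ∞ M)
    {γ : ℝ → M} {s : ℝ} (hγ : MDifferentiableAt 𝓘(ℝ, ℝ) (𝓡 n) γ s) (hs : γ s ∈ e.source) :
    F.toFun (velocity γ s) = inChart F.toFun e (e (γ s), deriv (e ∘ γ) s) := by
  rw [velocity_congr (eventuallyEq_symm_comp_comp e hγ.continuousAt hs),
    velocity_symm_comp he (differentiableAt_chart_comp he hγ hs) (e.map_source hs)]
  rfl

end FinslerStructure

theorem IsCoordProjectiveArc.exists_isProjectiveMap {F : FinslerStructure n M} {J : Set ℝ}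
    {X : ℝ → EuclideanSpace ℝ (Fin n)} {p : ℝ → ℝ}
    (h : IsCoordProjectiveArc e.target (inChart F.toFun e) J X p)
    (he : e ∈ IsManifold.maximalAtlas (𝓡 n) ∞ M) :
    ∃ f : ℝ → M, IsProjectiveMap F f ∧ ∀ s ∈ J, f (p s) = e.symm (X s) := by
  have hsource (s) (hs : s ∈ J) : (e.symm ∘ X) s ∈ e.source := e.map_target (h.mem s hs)
  have hchart (s) (hs : s ∈ J) : e ∘ (e.symm ∘ X) =ᶠ[𝓝 s] X := by
    filter_upwards [h.isOpen.mem_nhds hs] with t ht using e.right_inv (h.mem t ht)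
  have hf (s) (hs : s ∈ J) : (e.symm ∘ X ∘ Function.invFunOn p J) (p s) = (e.symm ∘ X) s := by
    simp only [Function.comp, h.bijOn.injOn.leftInvOn_invFunOn hs]
  refine ⟨e.symm ∘ X ∘ Function.invFunOn p J, ⟨J, e.symm ∘ X, p, h.isOpen, h.ordConnected,
    ⟨?_, fun s hs => ?_, fun s hs => ⟨e, he, hsource s hs, fun i => ?_⟩⟩,
    ⟨h.contDiffOn_param, h.deriv_ne_zero, fun s hs => ⟨e, he, hsource s hs, ?_⟩⟩,
    h.bijOn, hf⟩, hf⟩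
  · exact (contMDiffOn_symm_of_mem_maximalAtlas he).comp h.contDiffOn.contMDiffOn h.mem
  · have hX : DifferentiableAt ℝ X s :=
      (h.contDiffOn.contDiffAt (h.isOpen.mem_nhds hs)).differentiableAt (by simp)
    exact (congrArg F.toFun (velocity_symm_comp he hX (h.mem s hs))).trans (h.unit_speed s hs)
  · rw [(hchart s hs).deriv.deriv_eq, (hchart s hs).deriv_eq, h.geodesic s hs]
    have hval := (hchart s hs).eq_of_nhds
    simp only [Function.comp] at hval
    simp [sprayVector, hval]
  · rw [(hchart s hs).deriv_eq, h.schwarzian_eq s hs, ← (hchart s hs).eq_of_nhds]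
    rfl

end FinslerCharts

section PoincareDist

theorem poincareDist_comm (a b : ℝ) : poincareDist a b = poincareDist b a := by
  rw [poincareDist, poincareDist, ← abs_neg, ← Real.log_inv, inv_div]

theorem poincareDist_self (a : ℝ) : poincareDist a a = 0 := by
  by_cases h : (1 - a) * (1 + a) = 0
  · simp [poincareDist, h]
  · rw [poincareDist, div_self h, Real.log_one, abs_zero]

theorem poincareDist_nonneg (a b : ℝ) : 0 ≤ poincareDist a b := abs_nonneg _

theorem poincareDist_neg (a b : ℝ) : poincareDist (-a) (-b) = poincareDist a b := by
  rw [poincareDist_comm, poincareDist, poincareDist]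
  congr 2
  ring

theorem poincareDist_eq_two_mul_abs_artanh_sub {a b : ℝ} (ha : a ∈ Set.Ioo (-1 : ℝ) 1)
    (hb : b ∈ Set.Ioo (-1 : ℝ) 1) :
    poincareDist a b = 2 * |Real.artanh b - Real.artanh a| := by
  have ha₁ : 0 < 1 - a := by linarith [ha.2]
  have ha₂ : 0 < 1 + a := by linarith [ha.1]
  have hb₁ : 0 < 1 - b := by linarith [hb.2]
  have hb₂ : 0 < 1 + b := by linarith [hb.1]
  rw [poincareDist, Real.artanh_eq_half_log (Set.Ioo_subset_Icc_self ha),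
    Real.artanh_eq_half_log (Set.Ioo_subset_Icc_self hb), ← mul_sub, abs_mul,
    ← Real.log_div (by positivity) (by positivity), abs_of_pos (by norm_num : (0 : ℝ) < 1 / 2)]
  rw [← mul_assoc, mul_one_div_cancel two_ne_zero, one_mul]
  congr 2
  field_simp

theorem hasDerivAt_artanh {x : ℝ} (hx : x ∈ Set.Ioo (-1 : ℝ) 1) :
    HasDerivAt Real.artanh (1 - x ^ 2)⁻¹ x := by
  have hsub : 0 < 1 - x := by linarith [hx.2]
  have hadd : 0 < 1 + x := by linarith [hx.1]
  have hlog : HasDerivAt (fun x => 1 / 2 * Real.log ((1 + x) / (1 - x))) (1 - x ^ 2)⁻¹ x := by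
    have hquot := ((hasDerivAt_id' x).const_add 1).fun_div ((hasDerivAt_id' x).const_sub 1) hsub.ne'
    refine ((hquot.log (div_pos hadd hsub).ne').const_mul (1 / 2)).congr_deriv ?_
    rw [show 1 - x ^ 2 = (1 - x) * (1 + x) by ring]
    field_simp
    ring
  refine hlog.congr_of_eventuallyEq ?_
  filter_upwards [Ioo_mem_nhds hx.1 hx.2] with y hy
    using Real.artanh_eq_half_log (Set.Ioo_subset_Icc_self hy)

end PoincareDist

section Chains

variable {n : ℕ} {M : Type*} [TopologicalSpace M] [ChartedSpace (EuclideanSpace ℝ (Fin n)) M]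
  [IsManifold (𝓡 n) ∞ M] {F : FinslerStructure n M}

namespace GeodesicChain

theorem length_nonneg {x y : M} (α : GeodesicChain F x y) : 0 ≤ α.length :=
  Finset.sum_nonneg fun _ _ => poincareDist_nonneg _ _

/-- The chain from `f a` to `f b` along a single projective map `f`. -/
def single {f : ℝ → M} (hf : IsProjectiveMap F f) {a b : ℝ} (ha : a ∈ Set.Ioo (-1 : ℝ) 1)
    (hb : b ∈ Set.Ioo (-1 : ℝ) 1) : GeodesicChain F (f a) (f b) where
  k := 1
  one_le := le_rfl
  point i := if i = 0 then f a else f b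
  a _ := a
  b _ := b
  f _ := f
  point_zero := rfl
  point_last := rfl
  a_mem _ _ := ha
  b_mem _ _ := hb
  projective _ _ := hf
  map_a i hi := by simp [Nat.lt_one_iff.1 hi]
  map_b i _ := by simp

theorem length_single {f : ℝ → M} (hf : IsProjectiveMap F f) {a b : ℝ}
    (ha : a ∈ Set.Ioo (-1 : ℝ) 1) (hb : b ∈ Set.Ioo (-1 : ℝ) 1) :
    (single hf ha hb).length = poincareDist a b :=
  Finset.sum_range_one _

/-- The chain traversed backwards: the order of the segments and the two parameters of each
segment are exchanged. -/
def reverse {x y : M} (α : GeodesicChain F x y) : GeodesicChain F y x where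
  k := α.k
  one_le := α.one_le
  point i := α.point (α.k - i)
  a i := α.b (α.k - 1 - i)
  b i := α.a (α.k - 1 - i)
  f i := α.f (α.k - 1 - i)
  point_zero := by simpa using α.point_last
  point_last := by simpa using α.point_zero
  a_mem i hi := α.b_mem _ (by omega)
  b_mem i hi := α.a_mem _ (by omega)
  projective i hi := α.projective _ (by omega)
  map_a i hi := by
    rw [α.map_b _ (by omega)]
    congr 1
    omega
  map_b i hi := by
    rw [α.map_a _ (by omega)]
    congr 1
    omega

theorem length_reverse {x y : M} (α : GeodesicChain F x y) : α.reverse.length = α.length := by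
  unfold length
  rw [← Finset.sum_range_reflect]
  refine Finset.sum_congr rfl fun i hi => ?_
  have hi' : i < α.k := Finset.mem_range.1 hi
  have h : α.k - 1 - (α.k - 1 - i) = i := by omega
  simp only [reverse, h]
  exact poincareDist_comm _ _

/-- The concatenation of two chains. -/
def append {x y z : M} (α : GeodesicChain F x y) (β : GeodesicChain F y z) :
    GeodesicChain F x z where
  k := α.k + β.k
  one_le := α.one_le.trans (Nat.le_add_right _ _)
  point i := if i < α.k then α.point i else β.point (i - α.k)
  a i := if i < α.k then α.a i else β.a (i - α.k)
  b i := if i < α.k then α.b i else β.b (i - α.k)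
  f i := if i < α.k then α.f i else β.f (i - α.k)
  point_zero := by
    rw [if_pos (Nat.lt_of_succ_le α.one_le)]
    exact α.point_zero
  point_last := by simpa using β.point_last
  a_mem i hi := by
    split_ifs with h
    · exact α.a_mem i h
    · exact β.a_mem _ (by omega)
  b_mem i hi := by
    split_ifs with h
    · exact α.b_mem i h
    · exact β.b_mem _ (by omega)
  projective i hi := by
    split_ifs with h
    · exact α.projective i h
    · exact β.projective _ (by omega)
  map_a i hi := by
    split_ifs with h
    · exact α.map_a i h
    · exact β.map_a _ (by omega)
  map_b i hi := by
    by_cases h : i < α.k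
    · rw [if_pos h, if_pos h, α.map_b i h]
      split_ifs with h'
      · rfl
      · have : i + 1 = α.k := by omega
        rw [this, α.point_last, Nat.sub_self, β.point_zero]
    · rw [if_neg h, if_neg h, if_neg (by omega), β.map_b _ (by omega)]
      congr 1
      omega

theorem length_append {x y z : M} (α : GeodesicChain F x y) (β : GeodesicChain F y z) :
    (α.append β).length = α.length + β.length := by
  unfold length
  simp only [append]
  rw [Finset.sum_range_add]
  congr 1
  · refine Finset.sum_congr rfl fun i hi => ?_
    rw [if_pos (Finset.mem_range.1 hi), if_pos (Finset.mem_range.1 hi)]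
  · refine Finset.sum_congr rfl fun i _ => ?_
    simp

end GeodesicChain

theorem pseudoDist_comm (x y : M) : pseudoDist F x y = pseudoDist F y x := by
  have h : ∀ x y : M, pseudoDist F x y ≤ pseudoDist F y x := fun x y =>
    le_iInf fun α => (iInf_le _ α.reverse).trans_eq (by rw [α.length_reverse])
  exact le_antisymm (h x y) (h y x)

theorem pseudoDist_triangle (x y z : M) :
    pseudoDist F x z ≤ pseudoDist F x y + pseudoDist F y z := by
  unfold pseudoDist
  rw [ENNReal.iInf_add]
  refine le_iInf fun α => ?_
  rw [ENNReal.add_iInf]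
  refine le_iInf fun β => (iInf_le _ (α.append β)).trans_eq ?_
  rw [α.length_append, ENNReal.ofReal_add α.length_nonneg β.length_nonneg]

theorem pseudoDist_le_poincareDist {f : ℝ → M} (hf : IsProjectiveMap F f) {a b : ℝ}
    (ha : a ∈ Set.Ioo (-1 : ℝ) 1) (hb : b ∈ Set.Ioo (-1 : ℝ) 1) :
    pseudoDist F (f a) (f b) ≤ ENNReal.ofReal (poincareDist a b) :=
  (iInf_le _ (.single hf ha hb)).trans_eq (by rw [GeodesicChain.length_single])

theorem exists_eventually_nonempty_chain (hn : 0 < n) (F : FinslerStructure n M) (x : M) :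
    ∀ᶠ y in 𝓝 x, Nonempty (GeodesicChain F x y) := by
  set e := chartAt (EuclideanSpace ℝ (Fin n)) x
  have he : e ∈ IsManifold.maximalAtlas (𝓡 n) ∞ M := IsManifold.chart_mem_maximalAtlas x
  have hx : x ∈ e.source := mem_chart_source _ x
  obtain ⟨x₁, hx₁⟩ :=
    (F.isLocalFinsler he).exists_eventually_isCoordProjectiveArc hn (e.map_source hx)
  have hchain : ∀ᶠ y in 𝓝 x, Nonempty (GeodesicChain F (e.symm x₁) y) := by
    filter_upwards [(e.continuousAt hx).eventually hx₁, e.open_source.mem_nhds hx]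
      with y ⟨J, X, p, hp, ⟨s, hs, hsx⟩, ⟨t, ht, hty⟩⟩ hye
    obtain ⟨f, hf, hfp⟩ := hp.exists_isProjectiveMap he
    have α := GeodesicChain.single hf (hp.bijOn.mapsTo hs) (hp.bijOn.mapsTo ht)
    rw [hfp s hs, hfp t ht, hsx, hty, e.left_inv hye] at α
    exact ⟨α⟩
  obtain ⟨α⟩ := hchain.self_of_nhds
  filter_upwards [hchain] with y ⟨β⟩
  exact ⟨α.reverse.append β⟩

theorem nonempty_chain [ConnectedSpace M] (hn : 0 < n) (F : FinslerStructure n M) (x y : M) :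
    Nonempty (GeodesicChain F x y) :=
  PreconnectedSpace.induction₂' (fun x y => Nonempty (GeodesicChain F x y))
    (fun x => (exists_eventually_nonempty_chain hn F x).mono fun _ ⟨α⟩ => ⟨⟨α⟩, ⟨α.reverse⟩⟩)
    ⟨fun _ _ _ ⟨α⟩ ⟨β⟩ => ⟨α.append β⟩⟩ x y

theorem pseudoDist_lt_top [ConnectedSpace M] (hn : 0 < n) (F : FinslerStructure n M) (x y : M) :
    pseudoDist F x y < ⊤ := by
  obtain ⟨α⟩ := nonempty_chain hn F x y
  exact (iInf_le _ α).trans_lt ENNReal.ofReal_lt_top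

theorem pseudoDist_self (hn : 0 < n) (F : FinslerStructure n M) (x : M) :
    pseudoDist F x x = 0 := by
  obtain ⟨α⟩ := (exists_eventually_nonempty_chain hn F x).self_of_nhds
  have hpos : 0 < α.k := α.one_le
  have hx : α.f 0 (α.a 0) = x := (α.map_a 0 hpos).trans α.point_zero
  have hle := pseudoDist_le_poincareDist (α.projective 0 hpos) (α.a_mem 0 hpos) (α.a_mem 0 hpos)
  simpa only [hx, poincareDist_self, ENNReal.ofReal_zero, nonpos_iff_eq_zero] using hle

end Chains

section SchwarzLemma

open Set Filter

variable {J : Set ℝ} {p : ℝ → ℝ} {κ k r s t : ℝ}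

theorem deriv_deriv_nonpos_of_isLocalMax {f : ℝ → ℝ} (hmax : IsLocalMax f s)
    (hf : ContinuousAt f s) : deriv (deriv f) s ≤ 0 := by
  by_contra! hpos
  have hmin : IsLocalMin f s := isLocalMin_of_deriv_deriv_pos hpos hmax.deriv_eq_zero hf
  have hconst : f =ᶠ[𝓝 s] fun _ => f s := by
    filter_upwards [hmax, hmin] with t using le_antisymm
  simp [hconst.deriv.deriv_eq] at hpos

/-- The density of `ds` with respect to `dp / (r² - p²)`, which is a multiple of the Poincaré
metric of `(-r, r)`. -/
def poincareDensity (r : ℝ) (p : ℝ → ℝ) (s : ℝ) : ℝ :=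
  (r ^ 2 - p s ^ 2) / deriv p s

theorem poincareDensity_pos (hp : |p s| < r) (hp' : 0 < deriv p s) : 0 < poincareDensity r p s :=
  div_pos (sub_pos.2 (sq_lt_sq' (abs_lt.1 hp).1 (abs_lt.1 hp).2)) hp'

theorem hasDerivAt_poincareDensity (r : ℝ) (hp : DifferentiableAt ℝ p s)
    (hp' : DifferentiableAt ℝ (deriv p) s) (hne : deriv p s ≠ 0) :
    HasDerivAt (poincareDensity r p)
      (-2 * p s - poincareDensity r p s * (deriv (deriv p) s / deriv p s)) s := by
  have hnum := (hp.hasDerivAt.fun_pow 2).const_sub (r ^ 2)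
  refine (hnum.fun_div hp'.hasDerivAt hne).congr_deriv ?_
  rw [poincareDensity]
  field_simp
  ring

theorem hasDerivAt_deriv_div_deriv (hp' : DifferentiableAt ℝ (deriv p) s)
    (hp'' : DifferentiableAt ℝ (deriv (deriv p)) s) (hne : deriv p s ≠ 0) :
    HasDerivAt (fun s => deriv (deriv p) s / deriv p s)
      (schwarzian p s + (deriv (deriv p) s / deriv p s) ^ 2 / 2) s := by
  refine (hp''.hasDerivAt.fun_div hp'.hasDerivAt hne).congr_deriv ?_
  rw [schwarzian]
  field_simp
  ring

theorem neg_schwarzian_mul_poincareDensity_sq_le (hJ : IsOpen J) (hp : ContDiffOn ℝ 3 p J)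
    (hpos : ∀ s ∈ J, 0 < deriv p s) (hs : s ∈ J) (hmax : IsLocalMax (poincareDensity r p) s)
    (hψ : 0 ≤ poincareDensity r p s) :
    -schwarzian p s * poincareDensity r p s ^ 2 ≤ 2 * r ^ 2 := by
  have hp' : ContDiffOn ℝ 2 (deriv p) J := hp.deriv_of_isOpen hJ (by norm_num)
  have hp'' : ContDiffOn ℝ 1 (deriv (deriv p)) J := hp'.deriv_of_isOpen hJ (by norm_num)
  have hdiff (t) (ht : t ∈ J) : DifferentiableAt ℝ p t :=
    (hp.contDiffAt (hJ.mem_nhds ht)).differentiableAt (by simp)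
  have hdiff' (t) (ht : t ∈ J) : DifferentiableAt ℝ (deriv p) t :=
    (hp'.contDiffAt (hJ.mem_nhds ht)).differentiableAt (by simp)
  have hdiff'' : DifferentiableAt ℝ (deriv (deriv p)) s :=
    (hp''.contDiffAt (hJ.mem_nhds hs)).differentiableAt (by simp)
  have hψ' (t) (ht : t ∈ J) :=
    hasDerivAt_poincareDensity r (hdiff t ht) (hdiff' t ht) (hpos t ht).ne'
  have hψ'' := hasDerivAt_deriv_of_isOpen hJ hψ' hs <|
    ((hdiff s hs).hasDerivAt.const_mul (-2)).fun_sub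
      ((hψ' s hs).fun_mul (hasDerivAt_deriv_div_deriv (hdiff' s hs) hdiff'' (hpos s hs).ne'))
  have hcrit := hmax.hasDerivAt_eq_zero (hψ' s hs)
  have hle := deriv_deriv_nonpos_of_isLocalMax hmax (hψ' s hs).continuousAt
  rw [hψ''.deriv, hcrit] at hle
  have hmul : poincareDensity r p s * deriv p s = r ^ 2 - p s ^ 2 :=
    div_mul_cancel₀ _ (hpos s hs).ne'
  set ψ := poincareDensity r p s
  set a := deriv (deriv p) s / deriv p s
  have hsq : (ψ * a) ^ 2 = 4 * p s ^ 2 := by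
    linear_combination (2 * p s - ψ * a) * hcrit
  nlinarith [mul_nonpos_of_nonneg_of_nonpos hψ hle]

theorem exists_isLocalMax_poincareDensity (hJ : IsOpen J) (hJc : J.OrdConnected)
    (hp : ContDiffOn ℝ 1 p J) (hpos : ∀ s ∈ J, 0 < deriv p s) (hbij : BijOn p J (Ioo (-1) 1))
    (hs : s ∈ J) (hsr : |p s| < r) (hr : r < 1) :
    ∃ m ∈ J, IsLocalMax (poincareDensity r p) m ∧
      poincareDensity r p s ≤ poincareDensity r p m := by
  have hmono : StrictMonoOn p J :=
    strictMonoOn_of_deriv_pos hJc.convex hp.continuousOn fun t ht => hpos t (interior_subset ht)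
  have hr0 : 0 < r := (abs_nonneg _).trans_lt hsr
  obtain ⟨a, ha, hpa⟩ := hbij.surjOn (show -r ∈ Ioo (-1 : ℝ) 1 from ⟨by linarith, by linarith⟩)
  obtain ⟨b, hb, hpb⟩ := hbij.surjOn (show r ∈ Ioo (-1 : ℝ) 1 from ⟨by linarith, hr⟩)
  have has : a < s := (hmono.lt_iff_lt ha hs).1 (hpa ▸ (abs_lt.1 hsr).1)
  have hsb : s < b := (hmono.lt_iff_lt hs hb).1 (hpb ▸ (abs_lt.1 hsr).2)
  have hsub : Icc a b ⊆ J := hJc.out ha hb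
  have hcont : ContinuousOn (poincareDensity r p) (Icc a b) :=
    ((continuousOn_const.sub (hp.continuousOn.pow 2)).div
      (hp.continuousOn_deriv_of_isOpen hJ le_rfl) fun t ht => (hpos t ht).ne').mono hsub
  have hψs : 0 < poincareDensity r p s :=
    poincareDensity_pos hsr (hpos s hs)
  obtain ⟨m, hm, hmax⟩ : ∃ m ∈ Ioo a b, IsMaxOn (poincareDensity r p) (Icc a b) m := by
    refine isCompact_Icc.exists_isMaxOn_mem_subset hcont ⟨has.le, hsb.le⟩ ?_
    rw [Icc_sdiff_Ioo_same (has.trans hsb).le]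
    rintro _ (rfl | rfl)
    · simpa [poincareDensity, hpa] using hψs
    · simpa [poincareDensity, hpb] using hψs
  exact ⟨m, hsub (Ioo_subset_Icc_self hm), hmax.isLocalMax (Icc_mem_nhds hm.1 hm.2),
    hmax ⟨has.le, hsb.le⟩⟩

theorem mul_sq_le_of_schwarzian_le (hJ : IsOpen J) (hJc : J.OrdConnected)
    (hp : ContDiffOn ℝ 3 p J) (hpos : ∀ s ∈ J, 0 < deriv p s) (hbij : BijOn p J (Ioo (-1) 1))
    (hκ : 0 ≤ κ) (hS : ∀ s ∈ J, schwarzian p s ≤ -κ) (hs : s ∈ J) :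
    κ * (1 - p s ^ 2) ^ 2 ≤ 2 * deriv p s ^ 2 := by
  have hlt : |p s| < 1 := abs_lt.2 (hbij.mapsTo hs)
  have hr : ∀ᶠ r in 𝓝[<] 1, κ * (r ^ 2 - p s ^ 2) ^ 2 ≤ 2 * r ^ 2 * deriv p s ^ 2 := by
    filter_upwards [self_mem_nhdsWithin, mem_nhdsWithin_of_mem_nhds (lt_mem_nhds hlt)]
      with r (hr : r < 1) hsr
    obtain ⟨m, hm, hmax, hle⟩ :=
      exists_isLocalMax_poincareDensity hJ hJc (hp.of_le (by norm_num)) hpos hbij hs hsr hr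
    have hψs : 0 ≤ poincareDensity r p s :=
      (poincareDensity_pos hsr (hpos s hs)).le
    have hψ : κ * poincareDensity r p s ^ 2 ≤ 2 * r ^ 2 :=
      calc κ * poincareDensity r p s ^ 2 ≤ κ * poincareDensity r p m ^ 2 := by gcongr
        _ ≤ -schwarzian p m * poincareDensity r p m ^ 2 := by gcongr; exact le_neg.2 (hS m hm)
        _ ≤ 2 * r ^ 2 :=
          neg_schwarzian_mul_poincareDensity_sq_le hJ hp hpos hm hmax (hψs.trans hle)
    rwa [poincareDensity, div_pow, ← mul_div_assoc, div_le_iff₀ (pow_pos (hpos s hs) 2)] at hψ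
  have hleft : Continuous fun r : ℝ => κ * (r ^ 2 - p s ^ 2) ^ 2 := by fun_prop
  have hright : Continuous fun r : ℝ => 2 * r ^ 2 * deriv p s ^ 2 := by fun_prop
  simpa using le_of_tendsto_of_tendsto (hleft.continuousWithinAt (s := Iio 1) (x := 1))
    hright.continuousWithinAt hr

theorem mul_abs_sub_le_poincareDist_of_deriv_pos (hJ : IsOpen J) (hJc : J.OrdConnected)
    (hp : ContDiffOn ℝ 3 p J) (hpos : ∀ s ∈ J, 0 < deriv p s) (hbij : BijOn p J (Ioo (-1) 1))
    (hS : ∀ s ∈ J, schwarzian p s ≤ -(k ^ 2 / 2)) (hs : s ∈ J) (ht : t ∈ J) :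
    k * |t - s| ≤ poincareDist (p s) (p t) := by
  have hderiv (u) (hu : u ∈ J) : HasDerivAt (fun v => 2 * Real.artanh (p v))
      (2 * ((1 - p u ^ 2)⁻¹ * deriv p u)) u :=
    (((hasDerivAt_artanh (hbij.mapsTo hu)).comp u
      (((hp.contDiffAt (hJ.mem_nhds hu)).differentiableAt (by simp)).hasDerivAt)).const_mul 2)
  have hle (u) (hu : u ∈ J) : k ≤ 2 * ((1 - p u ^ 2)⁻¹ * deriv p u) := by
    have hden : 0 < 1 - p u ^ 2 := by nlinarith [(hbij.mapsTo hu).1, (hbij.mapsTo hu).2]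
    have hsq := mul_sq_le_of_schwarzian_le hJ hJc hp hpos hbij (by positivity) hS hu
    have hlin : k * (1 - p u ^ 2) ≤ 2 * deriv p u :=
      le_of_sq_le_sq (by linarith) (by linarith [hpos u hu])
    rwa [inv_mul_eq_div, ← mul_div_assoc, le_div_iff₀ hden]
  have hmono : ∀ u ∈ J, ∀ v ∈ J, u ≤ v →
      k * (v - u) ≤ 2 * Real.artanh (p v) - 2 * Real.artanh (p u) :=
    hJc.convex.mul_sub_le_image_sub_of_le_deriv
      (fun u hu => (hderiv u hu).continuousAt.continuousWithinAt)
      (fun u hu => (hderiv u (interior_subset hu)).differentiableAt.differentiableWithinAt)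
      (fun u hu => (hle u (interior_subset hu)).trans_eq (hderiv u (interior_subset hu)).deriv.symm)
  rw [poincareDist_eq_two_mul_abs_artanh_sub (hbij.mapsTo hs) (hbij.mapsTo ht)]
  rcases le_total s t with h | h
  · rw [abs_of_nonneg (sub_nonneg.2 h)]
    linarith [hmono s hs t ht h, le_abs_self (Real.artanh (p t) - Real.artanh (p s))]
  · rw [abs_of_nonpos (sub_nonpos.2 h)]
    linarith [hmono t ht s hs h, neg_le_abs (Real.artanh (p t) - Real.artanh (p s))]

theorem mul_abs_sub_le_poincareDist (hJ : IsOpen J) (hJc : J.OrdConnected)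
    (hp : ContDiffOn ℝ 3 p J) (hne : ∀ s ∈ J, deriv p s ≠ 0) (hbij : BijOn p J (Ioo (-1) 1))
    (hS : ∀ s ∈ J, schwarzian p s ≤ -(k ^ 2 / 2)) (hs : s ∈ J) (ht : t ∈ J) :
    k * |t - s| ≤ poincareDist (p s) (p t) := by
  have hderiv (s) (hs : s ∈ J) : HasDerivWithinAt p (deriv p s) J s :=
    ((hp.contDiffAt (hJ.mem_nhds hs)).differentiableAt (by simp)).hasDerivAt.hasDerivWithinAt
  rcases hasDerivWithinAt_forall_lt_or_forall_gt_of_forall_ne hJc.convex hderiv hne with hneg | hpos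
  · have hbij' : BijOn (fun s => -p s) J (Ioo (-1) 1) := by
      have hIoo : BijOn (Neg.neg : ℝ → ℝ) (Ioo (-1) 1) (Ioo (-1) 1) := by
        simpa using neg_injective.injOn.bijOn_image (s := Ioo (-1 : ℝ) 1)
      exact hIoo.comp hbij
    rw [← poincareDist_neg]
    exact mul_abs_sub_le_poincareDist_of_deriv_pos (p := fun s => -p s) hJ hJc hp.neg
      (fun s hs => by simpa using hneg s hs) hbij' (by simpa only [schwarzian_neg] using hS) hs ht
  · exact mul_abs_sub_le_poincareDist_of_deriv_pos hJ hJc hp hpos hbij hS hs ht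

end SchwarzLemma

section Separation

open Set Filter

variable {n : ℕ} {M : Type*} [TopologicalSpace M] [ChartedSpace (EuclideanSpace ℝ (Fin n)) M]
  [IsManifold (𝓡 n) ∞ M] {F : FinslerStructure n M}
  {e : OpenPartialHomeomorph M (EuclideanSpace ℝ (Fin n))}

theorem FinslerStructure.inChart_zero (F : FinslerStructure n M)
    (e : OpenPartialHomeomorph M (EuclideanSpace ℝ (Fin n))) (x : EuclideanSpace ℝ (Fin n)) :
    inChart F.toFun e (x, 0) = 0 := by
  have hzero : inChart F.toFun e (x, 0) = F.toFun ⟨e.symm x, 0⟩ :=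
    congrArg (fun y : TangentSpace (𝓡 n) (e.symm x) => F.toFun ⟨e.symm x, y⟩)
      (map_zero (mfderiv (𝓡 n) (𝓡 n) e.symm x))
  have htwo := F.homogeneous (e.symm x) 0 2 two_pos
  rw [smul_zero] at htwo
  linarith

theorem FinslerStructure.snd_ne_zero_of_inChart_eq_one (F : FinslerStructure n M)
    {z : PhaseSpace n} (hz : inChart F.toFun e z = 1) : z.2 ≠ 0 := by
  obtain ⟨x, y⟩ := z
  rintro rfl
  exact zero_ne_one ((F.inChart_zero e x).symm.trans hz)

theorem IsArcLengthGeodesicOn.mdifferentiableAt {J : Set ℝ} {γ : ℝ → M} {s : ℝ}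
    (hγ : IsArcLengthGeodesicOn F γ J) (hJ : IsOpen J) (hs : s ∈ J) :
    MDifferentiableAt 𝓘(ℝ, ℝ) (𝓡 n) γ s :=
  (hγ.smooth.contMDiffAt (hJ.mem_nhds hs)).mdifferentiableAt (by simp)

theorem IsArcLengthGeodesicOn.inChart_eq_one {J : Set ℝ} {γ : ℝ → M} {s : ℝ}
    (hγ : IsArcLengthGeodesicOn F γ J) (hJ : IsOpen J) (hs : s ∈ J)
    (he : e ∈ IsManifold.maximalAtlas (𝓡 n) ∞ M) (hγs : γ s ∈ e.source) :
    inChart F.toFun e (e (γ s), deriv (e ∘ γ) s) = 1 :=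
  (F.toFun_velocity he (hγ.mdifferentiableAt hJ hs) hγs).symm.trans (hγ.unit_speed s hs)

theorem RicciLE.sum_sum_ricciTensor_le {κ : ℝ} (hRic : RicciLE F κ)
    (he : e ∈ IsManifold.maximalAtlas (𝓡 n) ∞ M) {z : PhaseSpace n} (hz : z ∈ slit e.target) :
    ∑ i, ∑ j, ricciTensor (inChart F.toFun e) z i j * z.2 i * z.2 j
      ≤ κ * inChart F.toFun e z ^ 2 := by
  have hquad := (hRic e he z.1 hz.1 z.2 hz.2).dotProduct_mulVec_nonneg z.2.ofLp
  have hsum : star z.2.ofLp ⬝ᵥ ((κ • fundamentalTensor (inChart F.toFun e) (z.1, z.2)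
        - ricciTensor (inChart F.toFun e) (z.1, z.2)).mulVec z.2.ofLp)
      = κ * ∑ i, ∑ j, fundamentalTensor (inChart F.toFun e) z i j * z.2 i * z.2 j
        - ∑ i, ∑ j, ricciTensor (inChart F.toFun e) z i j * z.2 i * z.2 j := by
    simp only [dotProduct, Matrix.mulVec, Finset.mul_sum, ← Finset.sum_sub_distrib, Pi.star_apply,
      star_trivial, Matrix.sub_apply, Matrix.smul_apply, smul_eq_mul]
    refine Finset.sum_congr rfl fun i _ => Finset.sum_congr rfl fun j _ => ?_
    ring
  rw [hsum, (F.isLocalFinsler he).sum_sum_fundamentalTensor hz] at hquad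
  linarith

theorem RicciLE.projectiveRHS_le {c : ℝ} (hn : 2 ≤ n) (hRic : RicciLE F (-c ^ 2))
    (he : e ∈ IsManifold.maximalAtlas (𝓡 n) ∞ M) {z : PhaseSpace n} (hz : z.1 ∈ e.target)
    (hone : inChart F.toFun e z = 1) :
    projectiveRHS (inChart F.toFun e) z ≤ -((2 * c / √((n : ℝ) - 1)) ^ 2 / 2) := by
  have hn1 : (0 : ℝ) < (n : ℝ) - 1 := sub_pos.2 (by exact_mod_cast hn)
  have hle := hRic.sum_sum_ricciTensor_le he ⟨hz, F.snd_ne_zero_of_inChart_eq_one hone⟩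
  calc projectiveRHS (inChart F.toFun e) z
      ≤ 2 / ((n : ℝ) - 1) * (-c ^ 2 * inChart F.toFun e z ^ 2) := by
        rw [projectiveRHS]
        gcongr
    _ = -((2 * c / √((n : ℝ) - 1)) ^ 2 / 2) := by
        rw [hone, div_pow, Real.sq_sqrt hn1.le]
        ring

/-- A function on `M` that is `C`-Lipschitz in the arc length parameter of every geodesic. -/
def LipschitzAlongGeodesics (F : FinslerStructure n M) (C : ℝ) (h : M → ℝ) : Prop :=
  ∀ ⦃J : Set ℝ⦄ ⦃γ : ℝ → M⦄, IsOpen J → J.OrdConnected → IsArcLengthGeodesicOn F γ J →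
    ∀ s ∈ J, ∀ t ∈ J, |h (γ t) - h (γ s)| ≤ C * |t - s|

theorem LipschitzAlongGeodesics.abs_sub_le_poincareDist {C c : ℝ} {h : M → ℝ}
    (hh : LipschitzAlongGeodesics F C h) (hC : 0 ≤ C) (hc : 0 < c) (hn : 2 ≤ n)
    (hRic : RicciLE F (-c ^ 2)) {f : ℝ → M} (hf : IsProjectiveMap F f) {a b : ℝ}
    (ha : a ∈ Ioo (-1 : ℝ) 1) (hb : b ∈ Ioo (-1 : ℝ) 1) :
    |h (f b) - h (f a)| ≤ C / (2 * c / √((n : ℝ) - 1)) * poincareDist a b := by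
  obtain ⟨J, γ, p, hJ, hJc, hγ, hp, hbij, hfp⟩ := hf
  obtain ⟨s, hs, rfl⟩ := hbij.surjOn ha
  obtain ⟨t, ht, rfl⟩ := hbij.surjOn hb
  have hn1 : (0 : ℝ) < (n : ℝ) - 1 := sub_pos.2 (by exact_mod_cast hn)
  have hSchwarzian (u) (hu : u ∈ J) :
      schwarzian p u ≤ -((2 * c / √((n : ℝ) - 1)) ^ 2 / 2) := by
    obtain ⟨e, he, hsrc, heq⟩ := hp.schwarzian_eq u hu
    exact heq.trans_le <|
      hRic.projectiveRHS_le hn he (e.map_source hsrc) (hγ.inChart_eq_one hJ hu he hsrc)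
  have hdist := mul_abs_sub_le_poincareDist hJ hJc (hp.smooth.of_le (by norm_cast))
    hp.deriv_ne_zero hbij hSchwarzian hs ht
  rw [hfp s hs, hfp t ht]
  calc |h (γ t) - h (γ s)| ≤ C * |t - s| := hh hJ hJc hγ s hs t ht
    _ = C / (2 * c / √((n : ℝ) - 1)) * (2 * c / √((n : ℝ) - 1) * |t - s|) := by field_simp
    _ ≤ C / (2 * c / √((n : ℝ) - 1)) * poincareDist (p s) (p t) := by gcongr

theorem IsLocalFinsler.exists_abs_fderiv_le {U K : Set (EuclideanSpace ℝ (Fin n))}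
    {G : PhaseSpace n → ℝ} (hG : IsLocalFinsler U G) (hK : IsCompact K) (hKU : K ⊆ U)
    {H : EuclideanSpace ℝ (Fin n) → ℝ} (hH : ContDiffOn ℝ 1 H U) :
    ∃ C > 0, ∀ x ∈ K, ∀ y ≠ 0, |fderiv ℝ H x y| ≤ C * G (x, y) := by
  set S := K ×ˢ Metric.sphere (0 : EuclideanSpace ℝ (Fin n)) 1
  have hSU : S ⊆ slit U := fun z hz => ⟨hKU hz.1, ne_zero_of_mem_unit_sphere ⟨z.2, hz.2⟩⟩
  have hcont : ContinuousOn (fun z : PhaseSpace n => fderiv ℝ H z.1 z.2 / G z) S := by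
    refine ContinuousOn.div (ContinuousOn.clm_apply ?_ continuousOn_snd)
      (hG.contDiffOn.continuousOn.mono hSU) fun z hz => (hG.pos (hSU hz)).ne'
    exact (hH.continuousOn_fderiv_of_isOpen hG.isOpen le_rfl).comp continuousOn_fst
      fun z hz => hKU hz.1
  obtain ⟨C, hC⟩ := (hK.prod (isCompact_sphere _ _)).exists_bound_of_continuousOn hcont
  refine ⟨max C 1, lt_max_of_lt_right one_pos, fun x hx y hy => ?_⟩
  have hy' : 0 < ‖y‖⁻¹ := inv_pos.2 (norm_pos_iff.2 hy)
  have hpos : 0 < G (x, y) := hG.pos ⟨hKU hx, hy⟩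
  have hunit : (x, ‖y‖⁻¹ • y) ∈ S := ⟨hx, by simp [norm_smul, hy]⟩
  have hbound : |fderiv ℝ H x y / G (x, y)| ≤ C := by
    have hhom := hG.homogeneous (x, y) ⟨hKU hx, hy⟩ _ hy'
    rw [pow_one, smul_eq_mul] at hhom
    simpa only [hhom, Real.norm_eq_abs, map_smul, smul_eq_mul, mul_div_mul_left _ _ hy'.ne']
      using hC _ hunit
  rw [abs_div, abs_of_pos hpos, div_le_iff₀ hpos] at hbound
  exact hbound.trans (mul_le_mul_of_nonneg_right (le_max_left _ _) hpos.le)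

theorem IsArcLengthGeodesicOn.abs_deriv_comp_le {J : Set ℝ} {γ : ℝ → M} {s C : ℝ}
    (hγ : IsArcLengthGeodesicOn F γ J) (hJ : IsOpen J) (hs : s ∈ J)
    (he : e ∈ IsManifold.maximalAtlas (𝓡 n) ∞ M) (hγs : γ s ∈ e.source) {h : M → ℝ}
    (hh : DifferentiableAt ℝ (h ∘ e.symm) (e (γ s)))
    (hC : ∀ y ≠ 0, |fderiv ℝ (h ∘ e.symm) (e (γ s)) y| ≤ C * inChart F.toFun e (e (γ s), y)) :
    |deriv (h ∘ γ) s| ≤ C := by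
  have hdiff := hγ.mdifferentiableAt hJ hs
  have hunit := hγ.inChart_eq_one hJ hs he hγs
  have hlocal : h ∘ γ =ᶠ[𝓝 s] (h ∘ e.symm) ∘ (e ∘ γ) :=
    (eventuallyEq_symm_comp_comp e hdiff.continuousAt hγs).fun_comp h
  have hchain : deriv (h ∘ γ) s = fderiv ℝ (h ∘ e.symm) (e (γ s)) (deriv (e ∘ γ) s) :=
    hlocal.deriv_eq.trans
      (hh.hasFDerivAt.comp_hasDerivAt s (differentiableAt_chart_comp he hdiff hγs).hasDerivAt).deriv
  rw [hchain, ← mul_one C, ← hunit]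
  exact hC _ (F.snd_ne_zero_of_inChart_eq_one hunit)

theorem exists_lipschitzAlongGeodesics (F : FinslerStructure n M)
    (he : e ∈ IsManifold.maximalAtlas (𝓡 n) ∞ M) {h : M → ℝ}
    (hh : ContMDiff (𝓡 n) 𝓘(ℝ, ℝ) 1 h) (hcompact : HasCompactSupport h)
    (hsupp : tsupport h ⊆ e.source) : ∃ C > 0, LipschitzAlongGeodesics F C h := by
  have hK : IsCompact (e '' tsupport h) :=
    hcompact.isCompact.image_of_continuousOn (e.continuousOn.mono hsupp)
  have hH : ContDiffOn ℝ 1 (h ∘ e.symm) e.target := contMDiffOn_iff_contDiffOn.1 <|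
    hh.comp_contMDiffOn ((contMDiffOn_symm_of_mem_maximalAtlas he).of_le (by simp))
  obtain ⟨C, hC0, hC⟩ := (F.isLocalFinsler he).exists_abs_fderiv_le hK
    (image_subset_iff.2 fun z hz => e.map_source (hsupp hz)) hH
  refine ⟨C, hC0, fun J γ hJ hJc hγ s hs t ht => ?_⟩
  have hdiff (u) (hu : u ∈ J) : DifferentiableAt ℝ (h ∘ γ) u :=
    ((hh.mdifferentiableAt one_ne_zero).comp u (hγ.mdifferentiableAt hJ hu)).differentiableAt
  have hbound (u) (hu : u ∈ J) : ‖deriv (h ∘ γ) u‖ ≤ C := by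
    by_cases hmem : γ u ∈ tsupport h
    · exact hγ.abs_deriv_comp_le hJ hu he (hsupp hmem)
        ((hH.contDiffAt (e.open_target.mem_nhds (e.map_source (hsupp hmem)))).differentiableAt
          one_ne_zero) (hC _ (mem_image_of_mem e hmem))
    · have hzero : h ∘ γ =ᶠ[𝓝 u] fun _ => 0 :=
        (hγ.mdifferentiableAt hJ hu).continuousAt.eventually
          (notMem_tsupport_iff_eventuallyEq.1 hmem)
      simpa [hzero.deriv_eq] using hC0.le
  exact hJc.convex.norm_image_sub_le_of_norm_deriv_le hdiff hbound hs ht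

theorem GeodesicChain.abs_sub_le_mul_length {K : ℝ} {h : M → ℝ}
    (hh : ∀ f, IsProjectiveMap F f → ∀ a ∈ Ioo (-1 : ℝ) 1, ∀ b ∈ Ioo (-1 : ℝ) 1,
      |h (f b) - h (f a)| ≤ K * poincareDist a b) {x y : M} (α : GeodesicChain F x y) :
    |h y - h x| ≤ K * α.length := by
  have hstep (i) (hi : i ∈ Finset.range α.k) :
      |h (α.point (i + 1)) - h (α.point i)| ≤ K * poincareDist (α.a i) (α.b i) := by
    have hi := Finset.mem_range.1 hi
    rw [← α.map_a i hi, ← α.map_b i hi]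
    exact hh _ (α.projective i hi) _ (α.a_mem i hi) _ (α.b_mem i hi)
  calc |h y - h x| = |∑ i ∈ Finset.range α.k, (h (α.point (i + 1)) - h (α.point i))| := by
        rw [Finset.sum_range_sub fun i => h (α.point i), α.point_last, α.point_zero]
    _ ≤ ∑ i ∈ Finset.range α.k, |h (α.point (i + 1)) - h (α.point i)| :=
        Finset.abs_sum_le_sum_abs _ _
    _ ≤ ∑ i ∈ Finset.range α.k, K * poincareDist (α.a i) (α.b i) := Finset.sum_le_sum hstep
    _ = K * α.length := (Finset.mul_sum _ _ _).symm

theorem pseudoDist_pos [T2Space M] (hn : 2 ≤ n) {c : ℝ} (hc : 0 < c) (hRic : RicciLE F (-c ^ 2))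
    {x y : M} (hxy : x ≠ y) : 0 < pseudoDist F x y := by
  have hn1 : (0 : ℝ) < (n : ℝ) - 1 := sub_pos.2 (by exact_mod_cast hn)
  obtain ⟨h, -, hh⟩ := (SmoothBumpFunction.nhds_basis_tsupport (I := 𝓡 n) x).mem_iff.1
    (isOpen_ne.mem_nhds hxy)
  have hx : h x = 1 := h.eq_one
  have hy : h y = 0 := image_eq_zero_of_notMem_tsupport fun hmem => hh hmem rfl
  obtain ⟨C, hC, hLip⟩ := exists_lipschitzAlongGeodesics F
    (IsManifold.chart_mem_maximalAtlas (I := 𝓡 n) x) (h.contMDiff.of_le (by simp))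
    h.hasCompactSupport h.tsupport_subset_chartAt_source
  set K := C / (2 * c / √((n : ℝ) - 1))
  have hK : 0 < K := by positivity
  have hlength (α : GeodesicChain F x y) : 1 / K ≤ α.length := by
    have hle := α.abs_sub_le_mul_length fun f hf a ha b hb =>
      hLip.abs_sub_le_poincareDist hC.le hc hn hRic hf ha hb
    rw [hx, hy, zero_sub, abs_neg, abs_one] at hle
    exact (div_le_iff₀' hK).2 hle
  exact (ENNReal.ofReal_pos.2 (one_div_pos.2 hK)).trans_le
    (le_iInf fun α => ENNReal.ofReal_le_ofReal (hlength α))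

end Separation

end Finsler

end

theorem theorem2 {n : ℕ} (hn : 2 ≤ n) {M : Type*} [TopologicalSpace M] [T2Space M]
    [ConnectedSpace M] [ChartedSpace (EuclideanSpace ℝ (Fin n)) M] [IsManifold (𝓡 n) ∞ M]
    (F : Finsler.FinslerStructure n M) (c : ℝ) (hc : 0 < c)
    (hRic : Finsler.RicciLE F (-c ^ 2)) :
    (∀ x y : M, Finsler.pseudoDist F x y < ⊤) ∧
    (∀ x y : M, Finsler.pseudoDist F x y = 0 ↔ x = y) ∧
    (∀ x y : M, Finsler.pseudoDist F x y = Finsler.pseudoDist F y x) ∧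
    (∀ x y z : M, Finsler.pseudoDist F x z
      ≤ Finsler.pseudoDist F x y + Finsler.pseudoDist F y z) :=
  ⟨Finsler.pseudoDist_lt_top (by omega) F,
    fun x y => ⟨fun h => by_contra fun hxy => (Finsler.pseudoDist_pos hn hc hRic hxy).ne' h,
      fun h => h ▸ Finsler.pseudoDist_self (by omega) F x⟩,
    Finsler.pseudoDist_comm, Finsler.pseudoDist_triangle⟩
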